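/- Notation. Let $\mathrm{PSL}(2,\mathbb R)=\mathrm{SL}(2,\mathbb R)/\{\pm1\}$ act on the hyperbolic plane $\mathbb H^2$ (metric $(dx^2+dy^2)/y^2$) by Möbius transformations, let $\Gamma\le\mathrm{PSL}(2,\mathbb R)$ be a discrete subgroup, and suppose that every $\gamma\in\Gamma\setminus\{e\}$ is hyperbolic ($|\mathrm{tr}\,\gamma|>2$). Let $\mathcal X=T^1(\Gamma\backslash\mathbb H^2)$, and identify $\mathcal X$ with $X=\Gamma\backslash\mathrm{PSL}(2,\mathbb R)$ by letting $\Gamma g$ correspond to the class of the image under $g$ of the upward unit vector at $i$; the geodesic flow then becomes $\varphi_t(\Gamma g)=\Gamma ga_t$ with $a_t=[\mathrm{diag}(e^{t/2},e^{-t/2})]$. Let $\mathcal T(\Gamma g)=\Gamma g d_\pi$, $d_\pi=\big[\begin{smallmatrix}0&1\\-1&0\end{smallmatrix}\big]$, be time reversal, let $d_{\mathrm{PSL}}$ be the distance of the left-invariant Riemannian metric on $\mathrm{PSL}(2,\mathbb R)$ given by $\langle\xi,\eta\rangle=\mathrm{tr}(\xi^{\mathsf T}\eta)$ at the identity, and let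 $d_X(x_1,x_2)$ be the infimum of $d_{\mathrm{PSL}}(g_1,g_2)$ over all $g_i$ with $x_i=\Gamma g_i$. A $T$-periodic orbit is the orbit of a point $x$ with $\varphi_T(x)=x$, $T>0$ ($T$ need not be the minimal period). Partners. Let $\varepsilon>0$. A $T'$-periodic orbit $c'$ is an $\varepsilon$-partner orbit of a $T$-periodic orbit $c$ if there are an integer $L\ge2$, decompositions $0=t_0<\dots<t_L=T$ and $0=t_0'<\dots<t_L'=T'$, a permutation $\sigma$ of $\{0,\dots,L-1\}$ and points $x\in c$, $x'\in c'$ such that, for each $j$, either $d_X(\varphi_{t+t_j}(x),\varphi_{t+t'_{\sigma(j)}}(x'))<\varepsilon$ for all $t\in[0,t_{j+1}-t_j]$, or $d_X(\varphi_{t+t_j}(x),\varphi_{t-t'_{\sigma(j)+1}}(\mathcal T(x')))<\varepsilon$ for all $t\in[0,t_{j+1}-t_j]$. Let $c$ be the orbit of $x$ and $T=T_1+T_2+T_3+T_4$ with all $T_i>0$. The $T'$-periodic orbit $c'$ *differs from $c$ in both encounters, up to $\varepsilon$*, if there are $x'\in c'$ and $0=t_0'<t_1'<t_2'<t_3'<t_4'=T'$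 such that, with $t_j=T_1+\dots+T_j$, one has $|(t_{j+1}'-t_j')-T_{j+1}|<\varepsilon$ for $j=0,1,2,3$ and, for all $t\in[0,T_{j+1}]$, $d_X(\varphi_{t+t_j}(x),\varphi_{t+t_j'}(x'))<\varepsilon$ if $j\in\{0,2\}$ and $d_X(\varphi_{t+t_j}(x),\varphi_{t-t_{j+1}'}(\mathcal T(x')))<\varepsilon$ if $j\in\{1,3\}$. (So $c'$ follows the pieces of lengths $T_1,T_3$ in the same direction and those of lengths $T_2,T_4$ in the opposite direction; this fixes the orientation of $c'$.) Statement. Let a $T$-periodic orbit of the geodesic flow on $\mathcal X$, starting at the point that corresponds to $x\in X$, cross itself in configuration space at a time $T_1$, at an angle $\theta_1$, creating a loop of length $T_2$, and then cross itself again after a time $T_3$, at an angle $\theta_2$, creating a loop of length $T_4$, where $T_1,T_2,T_3,T_4>0$, $T_1+T_2+T_3+T_4=T$ and $\theta_1,\theta_2\in(0,\pi)$. That is, the velocity vectors at the times $T_1$ and $T_1+T_2$ have the same base point in $\Gamma\backslash\mathbb H^2$ and make the angle $\theta_1$ there, and so do those at the times $T_1+T_2+T_3$ and $T$, with the angle $\theta_2$.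 Put $\phi_i=\pi-\theta_i$ and $\phi=\max\{\phi_1,\phi_2\}$, and suppose $\phi<\tfrac13$. (a) The orbit has a $36|\sin(\phi/2)|$-partner orbit, which differs from it in both encounters up to $36|\sin(\phi/2)|$, and whose period $T'$ satisfies $$\Big|\frac{T'-T}{2}-\ln\Big(\big(1-\sin^2(\phi_1/2)\big)\big(1-\sin^2(\phi_2/2)\big)\Big)\Big|<\sin^2(\phi/2)\,\big(21e^{-T_1}+31e^{-T_2}+13e^{-T_3}+19e^{-T_4}\big).$$ (b) If $\Gamma\backslash\mathbb H^2$ is compact, then there is a constant $\varepsilon_*>0$, depending only on $\Gamma$, such that the partner is unique whenever in addition $\phi<\varepsilon_*/20$: any two $36|\sin(\phi/2)|$-partner orbits that differ from the orbit in both encounters up to $36|\sin(\phi/2)|$ are the same orbit, with the same period. Moreover $\varepsilon_*$ can be chosen as an expansivity constant: if $0<\varepsilon<\varepsilon_*$ and $x_1,x_2\in X$ have periods $S_1,S_2>0$ with $|S_1-S_2|\le\sqrt2\,\varepsilon$ and $d_X(\varphi_t(x_1),\varphi_t(x_2))<\varepsilon$ for all $t\in[0,\min\{S_1,S_2\}]$,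 then $S_1=S_2$ and the orbits of $x_1$ and $x_2$ coincide. -/

import Mathlib

open UpperHalfPlane
open scoped MatrixGroups

noncomputable section

namespace HadamardGutzwiller

/-! ### The group `PSL(2,ℝ)` and its one-parameter subgroups -/

/-- `PSL(2,ℝ) = SL(2,ℝ)/{±1}`. -/
abbrev G : Type := Matrix.ProjectiveSpecialLinearGroup (Fin 2) ℝ

/-- The class `[A] = {±A}` of a matrix `A ∈ SL(2,ℝ)`. -/
def proj : SL(2, ℝ) →* G := QuotientGroup.mk' _

/-- `A_t = diag(e^{t/2}, e^{-t/2})`. -/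
def diagMatrix (t : ℝ) : SL(2, ℝ) :=
  ⟨!![Real.exp (t / 2), 0; 0, Real.exp (-(t / 2))], by
    rw [Matrix.det_fin_two_of, ← Real.exp_add]; simp⟩

/-- `D_π`. -/
def reversalMatrix : SL(2, ℝ) :=
  ⟨!![0, 1; -1, 0], by rw [Matrix.det_fin_two_of]; simp⟩

/-- `γ ∈ PSL(2,ℝ)` is hyperbolic: the absolute value of its trace is greater than `2`. -/
def IsHyperbolic (γ : G) : Prop :=
  ∀ A : SL(2, ℝ), proj A = γ → 2 < |(A : Matrix (Fin 2) (Fin 2) ℝ).trace|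

/-! ### The left-invariant metric on `PSL(2,ℝ)` -/

/-- The speed at time `t` of a curve `M` in `SL(2,ℝ)`, for the left-invariant Riemannian metric
given at the identity by `⟨ξ, η⟩ = tr(ξᵀ η)`: the Frobenius norm of `M(t)⁻¹ M'(t)`. -/
def speed (M : ℝ → SL(2, ℝ)) (t : ℝ) : ℝ :=
  Real.sqrt (∑ i, ∑ j,
    ((((M t)⁻¹ : SL(2, ℝ)) : Matrix (Fin 2) (Fin 2) ℝ) *
      Matrix.of (fun k l => deriv (fun s => M s k l) t)) i j ^ 2)

/-- The Riemannian distance on `PSL(2,ℝ)`: the infimum of the lengths of the `C¹` curves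
joining two points. (Every `C¹` curve in `PSL(2,ℝ)` is the projection of one in `SL(2,ℝ)`.) -/
def distG (g₁ g₂ : G) : ℝ :=
  sInf {ℓ : ℝ | ∃ M : ℝ → SL(2, ℝ), (∀ i j, ContDiff ℝ 1 (fun t => M t i j)) ∧
    proj (M 0) = g₁ ∧ proj (M 1) = g₂ ∧ ℓ = ∫ t in (0 : ℝ)..1, speed M t}

/-! ### The space `X = Γ \ PSL(2,ℝ)` and its flow -/

/-- The space of right cosets `Γ g`. -/
abbrev X (Γ : Subgroup G) : Type := Quotient (QuotientGroup.rightRel Γ)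

/-- The point `Γ g` of `X`. -/
def pt (Γ : Subgroup G) (g : G) : X Γ := Quotient.mk _ g

/-- `Γ g ↦ Γ g h`. -/
def rightMul (Γ : Subgroup G) (h : G) : X Γ → X Γ :=
  Quotient.map (fun g => g * h) (by
    intro g₁ g₂ hg
    have hg' := QuotientGroup.rightRel_apply.1 hg
    refine QuotientGroup.rightRel_apply.2 ?_
    simpa [mul_assoc] using hg')

/-- The flow `φ_t(Γ g) = Γ g a_t`. -/
def flow (Γ : Subgroup G) (t : ℝ) : X Γ → X Γ := rightMul Γ (proj (diagMatrix t))

/-- Time reversal `Γ g ↦ Γ g d_π`. -/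
def timeReversal (Γ : Subgroup G) : X Γ → X Γ := rightMul Γ (proj reversalMatrix)

/-- `d_X(x₁, x₂)`: the infimum of `d_G(g₁, g₂)` over all `g₁, g₂` with `xᵢ = Γ gᵢ`. -/
def distX (Γ : Subgroup G) (x₁ x₂ : X Γ) : ℝ :=
  sInf {r : ℝ | ∃ g₁ g₂ : G, pt Γ g₁ = x₁ ∧ pt Γ g₂ = x₂ ∧ r = distG g₁ g₂}

/-- The orbit of a point. -/
def orbit (Γ : Subgroup G) (x : X Γ) : Set (X Γ) := Set.range (fun t => flow Γ t x)

/-- `c` is a periodic orbit of the flow and `T > 0` is a period of it. -/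
def IsPeriodicOrbit (Γ : Subgroup G) (c : Set (X Γ)) (T : ℝ) : Prop :=
  0 < T ∧ ∃ x, flow Γ T x = x ∧ c = orbit Γ x

/-! ### The surface `Γ \ ℍ`, its unit tangent bundle and its geodesics -/

/-- The preimage of `Γ` in `SL(2,ℝ)`. It acts on `ℍ` through `Γ`, since `-1` acts trivially. -/
def preim (Γ : Subgroup G) : Subgroup SL(2, ℝ) := Γ.comap proj

/-- The surface `Γ \ ℍ`, with the quotient topology. -/
abbrev Surface (Γ : Subgroup G) : Type := MulAction.orbitRel.Quotient (preim Γ) ℍ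

/-- A unit tangent vector of the hyperbolic plane, for the metric `(dx² + dy²)/y²`. -/
@[ext] structure UnitTangent where
  base : ℍ
  vec : ℂ
  unit : ‖vec‖ = base.im

/-- The denominator `cz + d`. -/
def den (A : SL(2, ℝ)) (z : ℍ) : ℂ := (A 1 0 : ℂ) * z + (A 1 1 : ℂ)

lemma den_eq (A : SL(2, ℝ)) (z : ℍ) : den A z = denom (A : GL (Fin 2) ℝ) z := by
  simp [den, denom]

lemma toGL_smul (A : SL(2, ℝ)) (z : ℍ) : (A : GL (Fin 2) ℝ) • z = A • z := by
  rw [MulAction.compHom_smul_def]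
  congr 1

lemma den_mul (A B : SL(2, ℝ)) (z : ℍ) : den (A * B) z = den A (B • z) * den B z := by
  have h := denom_cocycle_σ (A : GL (Fin 2) ℝ) (B : GL (Fin 2) ℝ) z
  rw [den_eq, den_eq, den_eq]
  rw [map_mul]
  simpa [σ, -map_mul, toGL_smul] using h

/-- Möbius transformations act on unit tangent vectors by their differentials; the derivative
of `z ↦ (az+b)/(cz+d)` at `z` is `1/(cz+d)²`. -/
instance : MulAction SL(2, ℝ) UnitTangent where
  smul A v :=
    { base := A • v.base
      vec := v.vec / den A v.base ^ 2
      unit := by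
        have h := UpperHalfPlane.im_smul_eq_div_normSq (A : GL (Fin 2) ℝ) v.base
        rw [norm_div, norm_pow, v.unit, den_eq, ← Complex.normSq_eq_norm_sq]
        rw [toGL_smul] at h
        simpa using h.symm }
  one_smul v := by
    apply UnitTangent.ext
    · exact one_smul _ v.base
    · change v.vec / den 1 v.base ^ 2 = v.vec
      simp [den]
  mul_smul A B v := by
    apply UnitTangent.ext
    · exact mul_smul A B v.base
    · change v.vec / den (A * B) v.base ^ 2 =
        v.vec / den B v.base ^ 2 / den A (B • v.base) ^ 2
      rw [den_mul, mul_pow, div_div, mul_comm]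

/-- The unit tangent bundle `T¹(Γ \ ℍ) = Γ \ T¹ℍ`. -/
abbrev TX (Γ : Subgroup G) : Type := MulAction.orbitRel.Quotient (preim Γ) UnitTangent

/-- The unit tangent vector of `Γ \ ℍ` represented by one of `ℍ`. -/
def TX.mk (Γ : Subgroup G) (v : UnitTangent) : TX Γ := Quotient.mk _ v

/-- An orbit of the geodesic flow on `T¹ℍ`: the velocity field of a unit-speed geodesic line,
that is, of an isometric embedding of `ℝ` into `ℍ`. -/
def IsGeodesicLine (v : ℝ → UnitTangent) : Prop :=
  Isometry (fun t => (v t).base) ∧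
    ∀ t, HasDerivAt (fun s => (((v s).base : ℍ) : ℂ)) (v t).vec t

/-- `p : ℝ → T¹(Γ \ ℍ)` is an orbit of the geodesic flow, parametrized by time. -/
def IsGeodesicOrbit (Γ : Subgroup G) (p : ℝ → TX Γ) : Prop :=
  ∃ v : ℝ → UnitTangent, IsGeodesicLine v ∧ ∀ t, p t = TX.mk Γ (v t)

/-- Two unit tangent vectors of `Γ \ ℍ` have the same base point and make the angle `θ` there.
(The hyperbolic metric is conformal, so its angles are those of `ℂ`.) -/
def MeetAtAngle (Γ : Subgroup G) (p q : TX Γ) (θ : ℝ) : Prop :=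
  ∃ v w : UnitTangent, TX.mk Γ v = p ∧ TX.mk Γ w = q ∧ v.base = w.base ∧
    InnerProductGeometry.angle v.vec w.vec = θ

/-- The orbit `p` crosses itself in configuration space at the time `τ`, at the angle
`θ ∈ (0, π)`, creating a loop of length `L`. -/
def CrossesItself (Γ : Subgroup G) (p : ℝ → TX Γ) (τ L θ : ℝ) : Prop :=
  0 < L ∧ 0 < θ ∧ θ < Real.pi ∧ MeetAtAngle Γ (p τ) (p (τ + L)) θ

/-- The unit tangent vector of `ℍ` at `i` that points upwards. -/
def upward : UnitTangent := ⟨UpperHalfPlane.I, Complex.I, by simp⟩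

lemma mk_smul_eq_of_proj_mul_inv_mem (Γ : Subgroup G) {A B : SL(2, ℝ)}
    (h : proj A * (proj B)⁻¹ ∈ Γ) (v : UnitTangent) : TX.mk Γ (A • v) = TX.mk Γ (B • v) := by
  refine Quotient.sound ⟨⟨A * B⁻¹, ?_⟩, ?_⟩
  · simpa [preim] using h
  · change (A * B⁻¹) • B • v = A • v
    rw [smul_smul, inv_mul_cancel_right]

/-- The identification `X → T¹(Γ \ ℍ)`: the point `Γ [A]` is the class of the image under `A` of
the upward unit vector at `i`. -/
def toTX (Γ : Subgroup G) : X Γ → TX Γ :=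
  Quotient.lift
    (Quotient.lift (fun A : SL(2, ℝ) => TX.mk Γ (A • upward)) (by
      intro A B h
      have hAB : proj A = proj B := Quotient.sound h
      exact mk_smul_eq_of_proj_mul_inv_mem Γ (by rw [hAB, mul_inv_cancel]; exact Γ.one_mem) _))
    (by
      intro g₁ g₂ h
      have h' := QuotientGroup.rightRel_apply.1 h
      induction g₁ using Quotient.inductionOn with | _ A
      induction g₂ using Quotient.inductionOn with | _ B
      exact (mk_smul_eq_of_proj_mul_inv_mem Γ h' _).symm)

/-! ### Partner orbits -/

/-- The orbit of `y'` stays `ε`-close to that of `y` during a time `ℓ`. -/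
def StaysClose (Γ : Subgroup G) (ε ℓ : ℝ) (y y' : X Γ) : Prop :=
  ∀ s ∈ Set.Icc 0 ℓ, distX Γ (flow Γ s y) (flow Γ s y') < ε

/-- The orbits `c`, `c'` with periods `T`, `T'` form an `ε`-orbit pair (`c'` is an `ε`-partner
orbit of `c`). -/
def IsPartner (Γ : Subgroup G) (ε : ℝ) (c : Set (X Γ)) (T : ℝ) (c' : Set (X Γ)) (T' : ℝ) :
    Prop :=
  IsPeriodicOrbit Γ c T ∧ IsPeriodicOrbit Γ c' T' ∧
  ∃ (L : ℕ) (t t' : Fin (L + 1) → ℝ) (σ : Equiv.Perm (Fin L)), 2 ≤ L ∧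
    StrictMono t ∧ t 0 = 0 ∧ t (Fin.last L) = T ∧
    StrictMono t' ∧ t' 0 = 0 ∧ t' (Fin.last L) = T' ∧
    ∃ x ∈ c, ∃ x' ∈ c', ∀ j : Fin L,
      StaysClose Γ ε (t j.succ - t j.castSucc)
        (flow Γ (t j.castSucc) x) (flow Γ (t' (σ j).castSucc) x') ∨
      StaysClose Γ ε (t j.succ - t j.castSucc)
        (flow Γ (t j.castSucc) x) (flow Γ (-t' (σ j).succ) (timeReversal Γ x'))

/-- `c'`, with period `T'`, is an `ε`-partner which differs in both encounters from the orbit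
that starts in `x` and runs through a stretch of length `T₁`, a loop of length `T₂`, a stretch
of length `T₃` and a loop of length `T₄`: up to `ε`, it runs through the four pieces in the same
order, through the stretches in the same and through the loops in the opposite direction, and
spends the same time on each of them. -/
def DiffersInBothEncounters (Γ : Subgroup G) (ε : ℝ) (x : X Γ) (T₁ T₂ T₃ T₄ : ℝ)
    (c' : Set (X Γ)) (T' : ℝ) : Prop :=
  IsPeriodicOrbit Γ c' T' ∧ ∃ x' ∈ c', ∃ t₁ t₂ t₃ : ℝ,
    0 < t₁ ∧ t₁ < t₂ ∧ t₂ < t₃ ∧ t₃ < T' ∧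
    |t₁ - T₁| < ε ∧ |(t₂ - t₁) - T₂| < ε ∧ |(t₃ - t₂) - T₃| < ε ∧ |(T' - t₃) - T₄| < ε ∧
    StaysClose Γ ε T₁ x x' ∧
    StaysClose Γ ε T₂ (flow Γ T₁ x) (flow Γ (-t₂) (timeReversal Γ x')) ∧
    StaysClose Γ ε T₃ (flow Γ (T₁ + T₂) x) (flow Γ t₂ x') ∧
    StaysClose Γ ε T₄ (flow Γ (T₁ + T₂ + T₃) x) (flow Γ (-T') (timeReversal Γ x'))

/-- `ε₀` is an expansivity constant for the periodic orbits of the flow. -/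
def IsExpansivityConstant (Γ : Subgroup G) (ε₀ : ℝ) : Prop :=
  0 < ε₀ ∧ ∀ ε, 0 < ε → ε < ε₀ → ∀ (x₁ x₂ : X Γ) (T₁ T₂ : ℝ), 0 < T₁ → 0 < T₂ →
    flow Γ T₁ x₁ = x₁ → flow Γ T₂ x₂ = x₂ → |T₁ - T₂| ≤ Real.sqrt 2 * ε →
    (∀ t ∈ Set.Icc 0 (min T₁ T₂), distX Γ (flow Γ t x₁) (flow Γ t x₂) < ε) →
    T₁ = T₂ ∧ orbit Γ x₁ = orbit Γ x₂

/-- The orbit `p` of the geodesic flow on `T¹(Γ \ ℍ)`, with period `T₁ + T₂ + T₃ + T₄`, crosses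
itself at the time `T₁`, at the angle `θ₁`, creating a loop of length `T₂`, and then again after
the time `T₃`, at the angle `θ₂`, creating a loop of length `T₄`. -/
structure HasTwoSelfCrossings (Γ : Subgroup G) (p : ℝ → TX Γ) (T₁ T₂ T₃ T₄ θ₁ θ₂ : ℝ) :
    Prop where
  isOrbit : IsGeodesicOrbit Γ p
  periodic : ∀ t, p (t + (T₁ + T₂ + T₃ + T₄)) = p t
  pos₁ : 0 < T₁
  pos₃ : 0 < T₃
  crossing₁ : CrossesItself Γ p T₁ T₂ θ₁
  crossing₂ : CrossesItself Γ p (T₁ + T₂ + T₃) T₄ θ₂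

end HadamardGutzwiller

end

open HadamardGutzwiller

noncomputable section

namespace HadamardGutzwiller

/-! ### Matrices -/

/-! Existence. Lift the orbit to frames in PSL(2,ℝ). At a crossing at angle θ, a deck transformation
carries the lifted frame at the end of the loop to the frame at its start, up to a rotation. After
time reversal this rotation turns vectors by ±(π - θ), a small angle, and its matrix has the entry
`s` with `s ^ 2 = sin² ((π - θ)/2)`. Running each loop backwards therefore gives a closed broken
geodesic with segments T₁, T₂, T₃, T₄ and four small corners, the two ends of a loop having the same
corner. The partner is the closed geodesic that shadows it.

The shadowing geodesic is found through its end points on the boundary circle. In the frame at the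
start of a segment they are `x` (past) and `1 / y` (future). Flowing through a segment contracts `x`
by `e^{-T}`, flowing back does the same to `y`, and corners act by Möbius maps (`rotateSlope`). A
fixed point of the composition around the loop yields the end points (`exists_slopes`, used once for
each end). Its bounds need strong contraction on the loops. Hyperbolicity supplies it: the deck
transformation of a crossing has trace of absolute value `|s| (e^{L/2} + e^{-L/2})`, and this
exceeds 2 only if `e^{-L} < s ^ 2` (`exp_neg_lt_of_isHyperbolic`).

A frame on the axis passes from one segment to the next by an exact matrix identity
(`diag_mul_rotation_mul_axisFrame`). It shows that a segment and its corner take the time `T + 2 log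
(c + s y')` on the axis. Summing, `(T' - T) / 2` is a sum of four logarithms, each equal to `log c`
up to `O(σ² e^{-T})`. The same frames, flowed along a segment, differ from those of the broken
geodesic by a matrix within O(σ) of the identity, which gives the distance bound.

Uniqueness. Two partners follow the same pieces of the given orbit with almost the same timing, so
they are close to each other for a whole period (`DiffersInBothEncounters.near`). On a compact
surface, closeness over a period forces a constant matching deck transformation, then equal
holonomies, then a connecting matrix that intertwines `a_T` and `a_S`. Such a matrix near the
identity is diagonal, so orbits and periods agree (`expansive`). -/

lemma proj_surjective : Function.Surjective proj := QuotientGroup.mk'_surjective _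

lemma proj_eq_iff {A B : SL(2, ℝ)} : proj A = proj B ↔ B = A ∨ B = -A := by
  have key : ∀ C : SL(2, ℝ), C ∈ Subgroup.center SL(2, ℝ) ↔ C = 1 ∨ C = -1 := by
    intro C
    rw [Matrix.SpecialLinearGroup.mem_center_iff]
    constructor
    · rintro ⟨r, hr, hC⟩
      have hr' : r ^ 2 = 1 := by simpa using hr
      rcases mul_eq_zero.1 (by linear_combination hr' : (r - 1) * (r + 1) = 0) with h | h
      · left; ext i j; rw [← hC, sub_eq_zero.1 h]; simp
      · right; ext i j; rw [← hC, eq_neg_of_add_eq_zero_left h]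
        fin_cases i <;> fin_cases j <;> simp
    · rintro (h | h)
      · exact ⟨1, by simp, by simp [h]⟩
      · refine ⟨-1, by simp, ?_⟩
        rw [h]; ext i j; fin_cases i <;> fin_cases j <;> simp
  have h1 : proj A = proj B ↔ A⁻¹ * B ∈ Subgroup.center SL(2, ℝ) := QuotientGroup.eq
  rw [h1, key, inv_mul_eq_iff_eq_mul, inv_mul_eq_iff_eq_mul]
  simp

/-- The upper unipotent matrix with the entry `p`. -/
def upperUnipotent (p : ℝ) : SL(2, ℝ) := ⟨!![1, p; 0, 1], by simp [Matrix.det_fin_two_of]⟩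

/-- The lower unipotent matrix with the entry `q`. -/
def lowerUnipotent (q : ℝ) : SL(2, ℝ) := ⟨!![1, 0; q, 1], by simp [Matrix.det_fin_two_of]⟩

/-- The rotation matrix with first row `(c, s)`. -/
def rotation (c s : ℝ) (h : c ^ 2 + s ^ 2 = 1) : SL(2, ℝ) :=
  ⟨!![c, s; -s, c], by rw [Matrix.det_fin_two_of]; linarith⟩

lemma sl2_det (A : SL(2, ℝ)) : A 0 0 * A 1 1 - A 0 1 * A 1 0 = 1 := by
  have h := A.2
  rwa [Matrix.det_fin_two] at h

lemma inv_apply_entries (A : SL(2, ℝ)) :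
    (A⁻¹) 0 0 = A 1 1 ∧ (A⁻¹) 0 1 = -A 0 1 ∧ (A⁻¹) 1 0 = -A 1 0 ∧ (A⁻¹) 1 1 = A 0 0 := by
  rw [Matrix.SpecialLinearGroup.SL2_inv_expl]
  simp

lemma mul_apply_two (A B : SL(2, ℝ)) (i j : Fin 2) :
    (A * B) i j = A i 0 * B 0 j + A i 1 * B 1 j := by
  rw [Matrix.SpecialLinearGroup.coe_mul, Matrix.mul_apply, Fin.sum_univ_two]

lemma sl2_ext {A B : SL(2, ℝ)} (h00 : A 0 0 = B 0 0) (h01 : A 0 1 = B 0 1)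
    (h10 : A 1 0 = B 1 0) (h11 : A 1 1 = B 1 1) : A = B := by
  apply Matrix.SpecialLinearGroup.ext
  intro i j
  fin_cases i <;> fin_cases j <;> assumption

@[simp] lemma upperUnipotent_00 (p : ℝ) : upperUnipotent p 0 0 = 1 := rfl
@[simp] lemma upperUnipotent_01 (p : ℝ) : upperUnipotent p 0 1 = p := rfl
@[simp] lemma upperUnipotent_10 (p : ℝ) : upperUnipotent p 1 0 = 0 := rfl
@[simp] lemma upperUnipotent_11 (p : ℝ) : upperUnipotent p 1 1 = 1 := rfl
@[simp] lemma lowerUnipotent_00 (p : ℝ) : lowerUnipotent p 0 0 = 1 := rfl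
@[simp] lemma lowerUnipotent_01 (p : ℝ) : lowerUnipotent p 0 1 = 0 := rfl
@[simp] lemma lowerUnipotent_10 (p : ℝ) : lowerUnipotent p 1 0 = p := rfl
@[simp] lemma lowerUnipotent_11 (p : ℝ) : lowerUnipotent p 1 1 = 1 := rfl
@[simp] lemma rotation_00 (c s : ℝ) (h) : rotation c s h 0 0 = c := rfl
@[simp] lemma rotation_01 (c s : ℝ) (h) : rotation c s h 0 1 = s := rfl
@[simp] lemma rotation_10 (c s : ℝ) (h) : rotation c s h 1 0 = -s := rfl
@[simp] lemma rotation_11 (c s : ℝ) (h) : rotation c s h 1 1 = c := rfl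
@[simp] lemma diagMatrix_00 (t : ℝ) : diagMatrix t 0 0 = Real.exp (t / 2) := rfl
@[simp] lemma diagMatrix_01 (t : ℝ) : diagMatrix t 0 1 = 0 := rfl
@[simp] lemma diagMatrix_10 (t : ℝ) : diagMatrix t 1 0 = 0 := rfl
@[simp] lemma diagMatrix_11 (t : ℝ) : diagMatrix t 1 1 = Real.exp (-(t / 2)) := rfl
@[simp] lemma reversalMatrix_00 : reversalMatrix 0 0 = 0 := rfl
@[simp] lemma reversalMatrix_01 : reversalMatrix 0 1 = 1 := rfl
@[simp] lemma reversalMatrix_10 : reversalMatrix 1 0 = -1 := rfl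
@[simp] lemma reversalMatrix_11 : reversalMatrix 1 1 = 0 := rfl

lemma diagMatrix_add (s t : ℝ) : diagMatrix (s + t) = diagMatrix s * diagMatrix t := by
  apply sl2_ext <;> simp only [mul_apply_two] <;> simp [← Real.exp_add] <;> ring

@[simp] lemma diagMatrix_zero : diagMatrix 0 = 1 := by
  apply sl2_ext <;> simp

lemma diagMatrix_neg (t : ℝ) : diagMatrix (-t) = (diagMatrix t)⁻¹ := by
  rw [eq_inv_iff_mul_eq_one, ← diagMatrix_add]; simp

lemma reversalMatrix_mul_self : reversalMatrix * reversalMatrix = -1 := by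
  apply sl2_ext <;> simp [mul_apply_two]

lemma proj_neg (A : SL(2, ℝ)) : proj (-A) = proj A := proj_eq_iff.2 (Or.inr (by simp))

@[simp] lemma proj_reversal_mul_self : proj reversalMatrix * proj reversalMatrix = 1 := by
  rw [← map_mul, reversalMatrix_mul_self, proj_neg, map_one]

lemma diagMatrix_mul_reversal (t : ℝ) :
    diagMatrix t * reversalMatrix = reversalMatrix * diagMatrix (-t) := by
  apply sl2_ext <;> simp [mul_apply_two] <;> ring

lemma rotation_mul_reversal (c s : ℝ) (h) :
    rotation c s h * reversalMatrix = reversalMatrix * rotation c s h := by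
  apply sl2_ext <;> simp [mul_apply_two]

/-! ### Bounds for the distance on `PSL(2,ℝ)` -/

lemma speed_eq {M : ℝ → SL(2, ℝ)} {t : ℝ} {M' : Matrix (Fin 2) (Fin 2) ℝ}
    (h : ∀ i j, HasDerivAt (fun s => M s i j) (M' i j) t) :
    speed M t = Real.sqrt (∑ i, ∑ j,
      ((((M t)⁻¹ : SL(2, ℝ)) : Matrix (Fin 2) (Fin 2) ℝ) * M') i j ^ 2) := by
  have : Matrix.of (fun k l => deriv (fun s => M s k l) t) = M' := by
    ext k l; simpa using (h k l).deriv
  rw [speed, this]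

lemma speed_nonneg (M : ℝ → SL(2, ℝ)) (t : ℝ) : 0 ≤ speed M t := Real.sqrt_nonneg _

lemma length_nonneg (M : ℝ → SL(2, ℝ)) : 0 ≤ ∫ t in (0 : ℝ)..1, speed M t :=
  intervalIntegral.integral_nonneg zero_le_one fun t _ => speed_nonneg M t

lemma distG_bddBelow (g₁ g₂ : G) : BddBelow {ℓ : ℝ | ∃ M : ℝ → SL(2, ℝ),
    (∀ i j, ContDiff ℝ 1 (fun t => M t i j)) ∧
    proj (M 0) = g₁ ∧ proj (M 1) = g₂ ∧ ℓ = ∫ t in (0 : ℝ)..1, speed M t} := by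
  refine ⟨0, ?_⟩
  rintro _ ⟨M, -, -, -, rfl⟩
  exact length_nonneg M

lemma distG_nonneg (g₁ g₂ : G) : 0 ≤ distG g₁ g₂ := by
  apply Real.sInf_nonneg
  rintro _ ⟨M, -, -, -, rfl⟩
  exact length_nonneg M

/-- A curve of left-translates has the same speed. -/
lemma speed_mul_left (A : SL(2, ℝ)) {N : ℝ → SL(2, ℝ)} {t : ℝ} {N' : Matrix (Fin 2) (Fin 2) ℝ}
    (h : ∀ i j, HasDerivAt (fun s => N s i j) (N' i j) t) :
    speed (fun s => A * N s) t = speed N t := by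
  have h2 : ∀ i j, HasDerivAt (fun s => (A * N s) i j)
      (((A : Matrix (Fin 2) (Fin 2) ℝ) * N') i j) t := by
    intro i j
    simp only [mul_apply_two, Matrix.mul_apply, Fin.sum_univ_two]
    exact ((h 0 j).const_mul _).add ((h 1 j).const_mul _)
  rw [speed_eq h, speed_eq h2, mul_inv_rev, Matrix.SpecialLinearGroup.coe_mul, Matrix.mul_assoc,
    ← Matrix.mul_assoc _ (A : Matrix (Fin 2) (Fin 2) ℝ), ← Matrix.SpecialLinearGroup.coe_mul]
  simp

/-- Right translation by the reversal preserves the speed. -/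
lemma speed_mul_reversal {N : ℝ → SL(2, ℝ)} {t : ℝ} {N' : Matrix (Fin 2) (Fin 2) ℝ}
    (h : ∀ i j, HasDerivAt (fun s => N s i j) (N' i j) t) :
    speed (fun s => N s * reversalMatrix) t = speed N t := by
  have h2 : ∀ i j, HasDerivAt (fun s => (N s * reversalMatrix) i j)
      ((N' * (reversalMatrix : Matrix (Fin 2) (Fin 2) ℝ)) i j) t := by
    intro i j
    simp only [mul_apply_two, Matrix.mul_apply, Fin.sum_univ_two]
    exact ((h i 0).mul_const _).add ((h i 1).mul_const _)
  rw [speed_eq h, speed_eq h2]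
  congr 1
  obtain ⟨h1, h3, h4, h5⟩ := inv_apply_entries (N t)
  obtain ⟨k1, k3, k4, k5⟩ := inv_apply_entries (N t * reversalMatrix)
  simp only [Matrix.mul_apply, Fin.sum_univ_two, h1, h3, h4, h5, k1, k3, k4, k5, mul_apply_two]
  simp
  ring

/-- Lets the Frobenius norm be bounded by the sum of the absolute values of the entries. -/
lemma sq_add_sq_le_sq_add {a b c d : ℝ} (ha : 0 ≤ a) (hb : 0 ≤ b) (hc : 0 ≤ c) (hd : 0 ≤ d) :
    a ^ 2 + b ^ 2 + (c ^ 2 + d ^ 2) ≤ (a + b + (c + d)) ^ 2 := by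
  nlinarith [mul_nonneg ha hb, mul_nonneg ha hc, mul_nonneg ha hd, mul_nonneg hb hc,
    mul_nonneg hb hd, mul_nonneg hc hd]

/-- The product `c_q b_p a_z`. -/
def lowerUpperDiag (q p z : ℝ) : SL(2, ℝ) :=
  lowerUnipotent q * upperUnipotent p * diagMatrix z

lemma lowerUpperDiag_entries (q p z : ℝ) :
    lowerUpperDiag q p z 0 0 = Real.exp (z / 2) ∧
    lowerUpperDiag q p z 0 1 = p * Real.exp (-(z / 2)) ∧
    lowerUpperDiag q p z 1 0 = q * Real.exp (z / 2) ∧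
    lowerUpperDiag q p z 1 1 = (q * p + 1) * Real.exp (-(z / 2)) := by
  simp [lowerUpperDiag, mul_apply_two]

lemma hasDerivAt_lowerUpperDiag (q p z t : ℝ) (i j : Fin 2) :
    HasDerivAt (fun s => lowerUpperDiag (q * s) (p * s) (z * s) i j)
      ((!![z / 2 * Real.exp (z * t / 2), (p - p * t * (z / 2)) * Real.exp (-(z * t / 2));
        (q + q * t * (z / 2)) * Real.exp (z * t / 2),
        (2 * q * p * t - (q * t * (p * t) + 1) * (z / 2)) * Real.exp (-(z * t / 2))] :
        Matrix (Fin 2) (Fin 2) ℝ) i j) t := by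
  have hid : ∀ k : ℝ, HasDerivAt (fun s : ℝ => k * s) k t := fun k => by
    simpa using (hasDerivAt_id t).const_mul k
  have he : HasDerivAt (fun s => Real.exp (z * s / 2)) (z / 2 * Real.exp (z * t / 2)) t := by
    have := ((hid z).div_const 2).exp
    rwa [mul_comm] at this
  have he' : HasDerivAt (fun s => Real.exp (-(z * s / 2)))
      (-(z / 2) * Real.exp (-(z * t / 2))) t := by
    have := (((hid z).div_const 2).neg).exp
    rwa [mul_comm] at this
  have e := fun s => lowerUpperDiag_entries (q * s) (p * s) (z * s)
  fin_cases i <;> fin_cases j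
  · simpa [(e _).1] using he
  · simp only [Fin.zero_eta, Fin.mk_one, (e _).2.1]
    refine ((hid p).mul he').congr_deriv ?_
    simp; ring
  · simp only [Fin.zero_eta, Fin.mk_one, (e _).2.2.1]
    refine ((hid q).mul he).congr_deriv ?_
    simp; ring
  · simp only [Fin.mk_one, (e _).2.2.2]
    refine ((((hid q).mul (hid p)).add_const 1).mul he').congr_deriv ?_
    simp; ring

lemma speed_lowerUpperDiag_le (q p z t : ℝ) (ht : t ∈ Set.Icc (0 : ℝ) 1) :
    speed (fun s => lowerUpperDiag (q * s) (p * s) (z * s)) t ≤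
      2 * |q| * |p| + |z| + Real.exp |z| * (|p| + |q| * p ^ 2 + |q|) := by
  rw [speed_eq (hasDerivAt_lowerUpperDiag q p z t)]
  obtain ⟨e1, e2, e3, e4⟩ := lowerUpperDiag_entries (q * t) (p * t) (z * t)
  obtain ⟨k1, k2, k3, k4⟩ := inv_apply_entries (lowerUpperDiag (q * t) (p * t) (z * t))
  simp only [Matrix.mul_apply, Fin.sum_univ_two, k1, k2, k3, k4, e1, e2, e3, e4]
  simp only [Matrix.of_apply, Matrix.cons_val_zero, Matrix.cons_val_one, Matrix.cons_val']
  set E := Real.exp (z * t / 2) with hE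
  have hE' : Real.exp (-(z * t / 2)) = E⁻¹ := Real.exp_neg _
  rw [hE']
  have hE0 : 0 < E := Real.exp_pos _
  have hzt : |z * t| ≤ |z| := by
    rw [abs_mul, abs_of_nonneg ht.1]
    exact mul_le_of_le_one_right (abs_nonneg _) ht.2
  have hE2 : E ^ 2 ≤ Real.exp |z| := by
    rw [hE, ← Real.exp_nat_mul]
    exact Real.exp_le_exp.2 (by push_cast; linarith [le_abs_self (z * t)])
  have hE3 : (E⁻¹) ^ 2 ≤ Real.exp |z| := by
    rw [hE, ← Real.exp_neg, ← Real.exp_nat_mul]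
    exact Real.exp_le_exp.2 (by push_cast; linarith [neg_abs_le (z * t)])
  -- The four entries of `M⁻¹ M'`; the derivative of the diagonal factor contributes only `±z / 2`.
  have hx1 : ((q * t * (p * t) + 1) * E⁻¹ * (z / 2 * E) +
      -(p * t * E⁻¹) * ((q + q * t * (z / 2)) * E)) = z / 2 - q * p * t := by
    field_simp; ring
  have hx2 : ((q * t * (p * t) + 1) * E⁻¹ * ((p - p * t * (z / 2)) * E⁻¹) +
      -(p * t * E⁻¹) * ((2 * q * p * t - (q * t * (p * t) + 1) * (z / 2)) * E⁻¹)) =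
      (E⁻¹) ^ 2 * (p - q * p ^ 2 * t ^ 2) := by
    ring
  have hx3 : (-(q * t * E) * (z / 2 * E) + E * ((q + q * t * (z / 2)) * E)) = E ^ 2 * q := by
    ring
  have hx4 : (-(q * t * E) * ((p - p * t * (z / 2)) * E⁻¹) +
      E * ((2 * q * p * t - (q * t * (p * t) + 1) * (z / 2)) * E⁻¹)) = q * p * t - z / 2 := by
    field_simp; ring
  rw [hx1, hx2, hx3, hx4]
  have hab : |q * p * t| ≤ |q| * |p| := by
    rw [abs_mul, abs_mul, abs_of_nonneg ht.1]
    exact mul_le_of_le_one_right (by positivity) ht.2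
  have hy1 : |z / 2 - q * p * t| ≤ |q| * |p| + |z| / 2 := by
    calc |z / 2 - q * p * t| ≤ |z / 2| + |q * p * t| := abs_sub _ _
      _ ≤ |q| * |p| + |z| / 2 := by rw [abs_div, abs_two]; linarith
  have hy2 : |(E⁻¹) ^ 2 * (p - q * p ^ 2 * t ^ 2)| ≤ Real.exp |z| * (|p| + |q| * p ^ 2) := by
    rw [abs_mul, abs_of_nonneg (sq_nonneg E⁻¹)]
    refine mul_le_mul hE3 ?_ (abs_nonneg _) (Real.exp_pos _).le
    refine (abs_sub _ _).trans (add_le_add le_rfl ?_)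
    rw [abs_mul, abs_mul, abs_of_nonneg (sq_nonneg p), abs_of_nonneg (sq_nonneg t)]
    exact mul_le_of_le_one_right (by positivity) (pow_le_one₀ ht.1 ht.2)
  have hy3 : |E ^ 2 * q| ≤ Real.exp |z| * |q| := by
    rw [abs_mul, abs_of_nonneg (sq_nonneg E)]
    exact mul_le_mul_of_nonneg_right hE2 (abs_nonneg _)
  have hy4 : |q * p * t - z / 2| ≤ |q| * |p| + |z| / 2 := by rwa [abs_sub_comm]
  rw [Real.sqrt_le_iff]
  refine ⟨by positivity, ?_⟩
  rw [← sq_abs (z / 2 - q * p * t), ← sq_abs ((E⁻¹) ^ 2 * _), ← sq_abs (E ^ 2 * q),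
    ← sq_abs (q * p * t - z / 2)]
  have := add_le_add (add_le_add hy1 hy2) (add_le_add hy3 hy4)
  refine le_trans ?_ (pow_le_pow_left₀ (by positivity)
    (this.trans (le_of_eq (by ring : _ = 2 * |q| * |p| + |z| +
      Real.exp |z| * (|p| + |q| * p ^ 2 + |q|)))) 2)
  exact sq_add_sq_le_sq_add (abs_nonneg _) (abs_nonneg _) (abs_nonneg _) (abs_nonneg _)

lemma distG_le_of_speed_le {M : ℝ → SL(2, ℝ)} (hM : ∀ i j, ContDiff ℝ 1 (fun t => M t i j))
    {B : ℝ} (hB : ∀ t ∈ Set.Icc (0 : ℝ) 1, speed M t ≤ B) :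
    distG (proj (M 0)) (proj (M 1)) ≤ B := by
  refine (csInf_le (distG_bddBelow _ _) ⟨M, hM, rfl, rfl, rfl⟩).trans ?_
  have := intervalIntegral.norm_integral_le_of_norm_le_const (a := 0) (b := 1) (C := B)
    (f := speed M) (fun t ht => by
      rw [Set.uIoc_of_le zero_le_one] at ht
      rw [Real.norm_of_nonneg (speed_nonneg M t)]
      exact hB t ⟨ht.1.le, ht.2⟩)
  exact (le_abs_self _).trans (by simpa using this)

lemma contDiff_lowerUpperDiag (q p z : ℝ) (i j : Fin 2) :
    ContDiff ℝ 1 (fun s => lowerUpperDiag (q * s) (p * s) (z * s) i j) := by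
  have e := fun s => lowerUpperDiag_entries (q * s) (p * s) (z * s)
  fin_cases i <;> fin_cases j
  · simp only [Fin.zero_eta, (e _).1]; fun_prop
  · simp only [Fin.zero_eta, Fin.mk_one, (e _).2.1]; fun_prop
  · simp only [Fin.zero_eta, Fin.mk_one, (e _).2.2.1]; fun_prop
  · simp only [Fin.mk_one, (e _).2.2.2]; fun_prop

@[simp] lemma lowerUpperDiag_zero : lowerUpperDiag 0 0 0 = 1 := by
  obtain ⟨e1, e2, e3, e4⟩ := lowerUpperDiag_entries 0 0 0
  apply sl2_ext <;> simp [e1, e2, e3, e4]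

lemma distG_mul_lowerUpperDiag_le (A : SL(2, ℝ)) (q p z : ℝ) :
    distG (proj A) (proj (A * lowerUpperDiag q p z)) ≤
      2 * |q| * |p| + |z| + Real.exp |z| * (|p| + |q| * p ^ 2 + |q|) := by
  have h := distG_le_of_speed_le (M := fun s => A * lowerUpperDiag (q * s) (p * s) (z * s))
    (fun i j => by
      simp only [mul_apply_two]
      exact (contDiff_const.mul (contDiff_lowerUpperDiag q p z _ _)).add
        (contDiff_const.mul (contDiff_lowerUpperDiag q p z _ _)))
    (fun t ht => by
      rw [speed_mul_left A (hasDerivAt_lowerUpperDiag q p z t)]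
      exact speed_lowerUpperDiag_le q p z t ht)
  simpa using h

/-- The matrix `d_π` is orthogonal, so translating the curve on the right by it does not change the
Frobenius norms and the bound persists. It serves the pieces that are followed in the opposite
direction. -/
lemma distG_mul_lowerUpperDiag_mul_reversal_le (A : SL(2, ℝ)) (q p z : ℝ) :
    distG (proj (A * reversalMatrix)) (proj (A * lowerUpperDiag q p z * reversalMatrix)) ≤
      2 * |q| * |p| + |z| + Real.exp |z| * (|p| + |q| * p ^ 2 + |q|) := by
  have h := distG_le_of_speed_le
    (M := fun s => A * (lowerUpperDiag (q * s) (p * s) (z * s) * reversalMatrix))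
    (fun i j => by
      simp only [mul_apply_two]
      have := contDiff_lowerUpperDiag q p z
      exact (contDiff_const.mul (((this _ _).mul contDiff_const).add
        ((this _ _).mul contDiff_const))).add (contDiff_const.mul
        (((this _ _).mul contDiff_const).add ((this _ _).mul contDiff_const))))
    (fun t ht => by
      have hd := hasDerivAt_lowerUpperDiag q p z t
      have h2 : ∀ i j, HasDerivAt (fun s => (lowerUpperDiag (q * s) (p * s) (z * s) *
          reversalMatrix) i j) ((Matrix.of (fun i j => deriv (fun s => (lowerUpperDiag (q * s)
          (p * s) (z * s) * reversalMatrix) i j) t)) i j) t := by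
        intro i j
        refine DifferentiableAt.hasDerivAt ?_
        simp only [mul_apply_two]
        exact ((hd _ _).differentiableAt.mul_const _).add ((hd _ _).differentiableAt.mul_const _)
      rw [speed_mul_left A h2, speed_mul_reversal hd]
      exact speed_lowerUpperDiag_le q p z t ht)
  simpa [mul_assoc] using h

/-! ### Nearby points of the group have nearby matrices -/

/-- All entries of `A - 1` are at most `δ` in absolute value. -/
def Close (δ : ℝ) (A : SL(2, ℝ)) : Prop := ∀ i j, |A i j - (1 : SL(2, ℝ)) i j| ≤ δ

/-- Any matrix of determinant one is a product of four unipotent matrices. -/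
lemma exists_eq_unipotent_mul (A : SL(2, ℝ)) : ∃ x y z w : ℝ,
    A = upperUnipotent x * lowerUnipotent y * upperUnipotent z * lowerUnipotent w := by
  -- Three factors suffice if the lower left entry is nonzero. Otherwise right multiplication by
  -- `lowerUnipotent 1` makes that entry `A 1 1`, which is nonzero.
  have key : ∀ B : SL(2, ℝ), B 1 0 ≠ 0 → ∃ x y z : ℝ,
      B = upperUnipotent x * lowerUnipotent y * upperUnipotent z := by
    intro B hB
    refine ⟨(B 0 0 - 1) / B 1 0, B 1 0, (B 1 1 - 1) / B 1 0, ?_⟩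
    have hd := sl2_det B
    apply sl2_ext <;> simp [mul_apply_two] <;> field_simp
    · ring
    · linarith
    · ring
  by_cases h : A 1 0 = 0
  · have hd := sl2_det A
    have h11 : A 1 1 ≠ 0 := by
      intro h'; rw [h, h'] at hd; simp at hd
    obtain ⟨x, y, z, hB⟩ := key (A * lowerUnipotent 1) (by simpa [mul_apply_two, h] using h11)
    refine ⟨x, y, z, -1, ?_⟩
    rw [← hB]
    apply sl2_ext <;> simp [mul_apply_two]
  · obtain ⟨x, y, z, hB⟩ := key A h
    refine ⟨x, y, z, 0, ?_⟩
    rw [hB]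
    apply sl2_ext <;> simp [mul_apply_two]

/-- Shrink the four unipotent parameters to zero. The set of lengths that defines `distG` is thus
nonempty, so its infimum is not the default value of `sInf ∅`, and a small distance does provide a
short curve. -/
lemma exists_curve (g₁ g₂ : G) : ∃ M : ℝ → SL(2, ℝ), (∀ i j, ContDiff ℝ 1 (fun t => M t i j)) ∧
    proj (M 0) = g₁ ∧ proj (M 1) = g₂ := by
  obtain ⟨A, rfl⟩ := proj_surjective g₁
  obtain ⟨B, rfl⟩ := proj_surjective g₂
  obtain ⟨x, y, z, w, h⟩ := exists_eq_unipotent_mul (A⁻¹ * B)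
  refine ⟨fun t => A * (upperUnipotent (t * x) * lowerUnipotent (t * y) * upperUnipotent (t * z) *
    lowerUnipotent (t * w)), ?_, ?_, ?_⟩
  · intro i j
    fin_cases i <;> fin_cases j <;> simp [mul_apply_two] <;> fun_prop
  · congr 1
    apply sl2_ext <;> simp [mul_apply_two]
  · simp only [one_mul, ← h, mul_inv_cancel_left]

lemma exists_max_of_continuous {f : Fin 2 → Fin 2 → ℝ → ℝ} (hf : ∀ i j, Continuous (f i j)) :
    ∃ t₀ ∈ Set.Icc (0 : ℝ) 1, ∃ i₀ j₀, ∀ t ∈ Set.Icc (0 : ℝ) 1, ∀ i j, f i j t ≤ f i₀ j₀ t₀ := by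
  have h : ∀ u : Fin 2 × Fin 2, ∃ t₀ ∈ Set.Icc (0 : ℝ) 1, ∀ t ∈ Set.Icc (0 : ℝ) 1,
      f u.1 u.2 t ≤ f u.1 u.2 t₀ := fun u =>
    isCompact_Icc.exists_isMaxOn ⟨0, by simp⟩ (hf u.1 u.2).continuousOn
  choose τ hτ hmax using h
  obtain ⟨u, hu⟩ := Finite.exists_max fun u : Fin 2 × Fin 2 => f u.1 u.2 (τ u)
  exact ⟨τ u, hτ u, u.1, u.2, fun t ht i j => (hmax (i, j) t ht).trans (hu (i, j))⟩

/-- Points at a small distance differ by a matrix close to the identity. -/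
lemma exists_close_of_distG_lt {g₁ g₂ : G} {ε : ℝ} (hε : ε ≤ 1 / 4) (h : distG g₁ g₂ < ε) :
    ∃ N : SL(2, ℝ), g₁⁻¹ * g₂ = proj N ∧ Close (2 * ε) N := by
  obtain ⟨M₀, hM₀⟩ := exists_curve g₁ g₂
  obtain ⟨ℓ, ⟨M, hM, rfl, rfl, rfl⟩, hℓ⟩ := exists_lt_of_csInf_lt
    (s := {ℓ : ℝ | ∃ M : ℝ → SL(2, ℝ), (∀ i j, ContDiff ℝ 1 (fun t => M t i j)) ∧
      proj (M 0) = g₁ ∧ proj (M 1) = g₂ ∧ ℓ = ∫ t in (0 : ℝ)..1, speed M t})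
    ⟨_, M₀, hM₀.1, hM₀.2.1, hM₀.2.2, rfl⟩ h
  refine ⟨(M 0)⁻¹ * M 1, by simp, ?_⟩
  set D : ℝ → Matrix (Fin 2) (Fin 2) ℝ := fun t => Matrix.of (fun i j => deriv (fun s => M s i j) t)
    with hD
  have hDc : ∀ i j, Continuous (fun t => D t i j) := fun i j =>
    (hM i j).continuous_deriv le_rfl
  have hMc : ∀ i j, Continuous (fun t => M t i j) := fun i j => (hM i j).continuous
  have hMd : ∀ t i j, HasDerivAt (fun s => M s i j) (D t i j) t := fun t i j =>
    ((hM i j).differentiable one_ne_zero t).hasDerivAt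
  set N : ℝ → SL(2, ℝ) := fun t => (M 0)⁻¹ * M t with hN
  set ξ : ℝ → Matrix (Fin 2) (Fin 2) ℝ := fun t =>
    (((M t)⁻¹ : SL(2, ℝ)) : Matrix (Fin 2) (Fin 2) ℝ) * D t with hξ
  have hξc : ∀ i j, Continuous (fun t => ξ t i j) := by
    intro i j
    simp only [hξ, Matrix.mul_apply, Fin.sum_univ_two]
    have := fun t => inv_apply_entries (M t)
    fin_cases i
    · simp only [Fin.zero_eta, (this _).1, (this _).2.1]
      exact ((hMc 1 1).mul (hDc _ _)).add ((hMc 0 1).neg.mul (hDc _ _))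
    · simp only [Fin.mk_one, (this _).2.2.1, (this _).2.2.2]
      exact ((hMc 1 0).neg.mul (hDc _ _)).add ((hMc 0 0).mul (hDc _ _))
  have hsp : speed M = fun t => Real.sqrt (∑ i, ∑ j, ξ t i j ^ 2) := rfl
  have hspc : Continuous (speed M) := by
    rw [hsp]
    exact (continuous_finsetSum _ fun i _ => continuous_finsetSum _ fun j _ =>
      (hξc i j).pow 2).sqrt
  have hξle : ∀ t i j, |ξ t i j| ≤ speed M t := by
    intro t i j
    rw [hsp]
    refine Real.abs_le_sqrt ?_
    refine le_trans ?_ (Finset.single_le_sum (f := fun i => ∑ j, ξ t i j ^ 2)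
      (fun i _ => Finset.sum_nonneg fun j _ => sq_nonneg _) (Finset.mem_univ i))
    exact Finset.single_le_sum (f := fun j => ξ t i j ^ 2) (fun j _ => sq_nonneg _)
      (Finset.mem_univ j)
  -- The curve solves `N' = N ξ`, `N 0 = 1`, with the entries of `ξ` bounded by the speed: a
  -- Grönwall situation, treated below through the maximum `m` of `|N - 1|`.
  have hNd : ∀ t i j, HasDerivAt (fun s => N s i j) (N t i 0 * ξ t 0 j + N t i 1 * ξ t 1 j) t := by
    intro t i j
    have h1 : HasDerivAt (fun s => N s i j) (((M 0)⁻¹ : SL(2, ℝ)) i 0 * D t 0 j +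
        ((M 0)⁻¹ : SL(2, ℝ)) i 1 * D t 1 j) t := by
      simp only [hN, mul_apply_two]
      exact ((hMd t 0 j).const_mul _).add ((hMd t 1 j).const_mul _)
    convert h1 using 1
    have h2 : ((N t : Matrix (Fin 2) (Fin 2) ℝ) * ξ t) =
        (((M 0)⁻¹ : SL(2, ℝ)) : Matrix (Fin 2) (Fin 2) ℝ) * D t := by
      rw [hξ, hN]
      simp only
      rw [← Matrix.mul_assoc, ← Matrix.SpecialLinearGroup.coe_mul]
      simp
    have h3 := congrFun (congrFun h2 i) j
    simpa only [Matrix.mul_apply, Fin.sum_univ_two] using h3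
  have hNc : ∀ i j, Continuous (fun t => N t i j) := fun i j =>
    continuous_iff_continuousAt.2 fun t => (hNd t i j).continuousAt
  -- the maximal deviation from the identity
  obtain ⟨t₀, ht₀, i₀, j₀, hle⟩ := exists_max_of_continuous
    (f := fun i j t => |N t i j - (1 : SL(2, ℝ)) i j|)
    (fun i j => ((hNc i j).sub continuous_const).abs)
  set m := |N t₀ i₀ j₀ - (1 : SL(2, ℝ)) i₀ j₀| with hm
  have hm0 : 0 ≤ m := abs_nonneg _
  have hbound : ∀ t ∈ Set.Icc (0 : ℝ) 1, ∀ i j,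
      |N t i 0 * ξ t 0 j + N t i 1 * ξ t 1 j| ≤ (1 + 2 * m) * speed M t := by
    intro t ht i j
    have a0 := hle t ht i 0
    have a1 := hle t ht i 1
    have hs0 := hξle t 0 j
    have hs1 := hξle t 1 j
    have hsum : |N t i 0| + |N t i 1| ≤ 1 + 2 * m := by
      fin_cases i
      · simp at a0 a1 ⊢
        have := abs_sub_abs_le_abs_sub (N t 0 0) 1
        rw [abs_one] at this
        linarith
      · simp at a0 a1 ⊢
        have := abs_sub_abs_le_abs_sub (N t 1 1) 1
        rw [abs_one] at this
        linarith
    calc _ ≤ |N t i 0| * |ξ t 0 j| + |N t i 1| * |ξ t 1 j| := by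
          rw [← abs_mul, ← abs_mul]; exact abs_add_le _ _
      _ ≤ |N t i 0| * speed M t + |N t i 1| * speed M t := by gcongr
      _ = (|N t i 0| + |N t i 1|) * speed M t := by ring
      _ ≤ _ := mul_le_mul_of_nonneg_right hsum (speed_nonneg _ _)
  have hN0 : N 0 = 1 := by simp [hN]
  set L := ∫ t in (0 : ℝ)..1, speed M t with hL
  have hmL : m ≤ (1 + 2 * m) * L := by
    have hcont : Continuous fun t => N t i₀ 0 * ξ t 0 j₀ + N t i₀ 1 * ξ t 1 j₀ :=
      ((hNc _ _).mul (hξc _ _)).add ((hNc _ _).mul (hξc _ _))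
    have hint := intervalIntegral.integral_eq_sub_of_hasDerivAt (a := 0) (b := t₀)
      (fun t _ => hNd t i₀ j₀) (hcont.intervalIntegrable _ _)
    rw [hN0] at hint
    have hmi : m = |∫ t in (0 : ℝ)..t₀, N t i₀ 0 * ξ t 0 j₀ + N t i₀ 1 * ξ t 1 j₀| := by rw [hint]
    refine hmi.le.trans ((intervalIntegral.abs_integral_le_integral_abs ht₀.1).trans ?_)
    calc _ ≤ ∫ t in (0 : ℝ)..t₀, (1 + 2 * m) * speed M t := by
          refine intervalIntegral.integral_mono_on ht₀.1 (hcont.abs.intervalIntegrable _ _)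
            ((continuous_const.mul hspc).intervalIntegrable _ _) ?_
          intro t ht
          exact hbound t ⟨ht.1, ht.2.trans ht₀.2⟩ i₀ j₀
      _ ≤ ∫ t in (0 : ℝ)..1, (1 + 2 * m) * speed M t := by
          refine intervalIntegral.integral_mono_interval le_rfl ht₀.1 ht₀.2 ?_
            ((continuous_const.mul hspc).intervalIntegrable _ _)
          refine Filter.Eventually.of_forall fun t => ?_
          exact mul_nonneg (by linarith) (speed_nonneg _ _)
      _ = _ := by rw [intervalIntegral.integral_const_mul]
  have hL0 : 0 ≤ L := length_nonneg M
  intro i j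
  refine (hle 1 ⟨zero_le_one, le_rfl⟩ i j).trans ?_
  -- Since `L < 1 / 4`, the inequality `m ≤ (1 + 2 m) L` gives `m ≤ L / (1 - 2 L) ≤ 2 L`.
  have hLε : L < ε := hℓ
  nlinarith

/-! ### Geodesics and crossings -/

@[simp] lemma smul_base (A : SL(2, ℝ)) (v : UnitTangent) : (A • v).base = A • v.base := rfl

@[simp] lemma smul_vec (A : SL(2, ℝ)) (v : UnitTangent) :
    (A • v).vec = v.vec / den A v.base ^ 2 := rfl

@[simp] lemma upward_base : upward.base = UpperHalfPlane.I := rfl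

@[simp] lemma upward_vec : upward.vec = Complex.I := rfl

lemma den_ne_zero (A : SL(2, ℝ)) (z : ℍ) : den A z ≠ 0 := by
  rw [den_eq]; exact denom_ne_zero _ _

lemma coe_smul_eq (A : SL(2, ℝ)) (z : ℍ) :
    ((A • z : ℍ) : ℂ) = ((A 0 0 : ℂ) * z + (A 0 1 : ℂ)) / den A z := by
  rw [coe_specialLinearGroup_apply]; rfl

/-- The differential of a Möbius transformation. -/
lemma hasDerivAt_smul (A : SL(2, ℝ)) {z : ℝ → ℍ} {w : ℂ} {t : ℝ}
    (h : HasDerivAt (fun s => ((z s : ℍ) : ℂ)) w t) :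
    HasDerivAt (fun s => ((A • z s : ℍ) : ℂ)) (w / den A (z t) ^ 2) t := by
  simp only [coe_smul_eq]
  have h1 : HasDerivAt (fun s => (A 0 0 : ℂ) * (z s : ℂ) + (A 0 1 : ℂ)) ((A 0 0 : ℂ) * w) t :=
    (h.const_mul _).add_const _
  have h2 : HasDerivAt (fun s => den A (z s)) ((A 1 0 : ℂ) * w) t :=
    (h.const_mul _).add_const _
  refine (h1.div h2 (den_ne_zero A _)).congr_deriv ?_
  congr 1
  have hd : (A 0 0 : ℂ) * A 1 1 - A 0 1 * A 1 0 = 1 := by exact_mod_cast sl2_det A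
  simp only [den]
  linear_combination w * hd

/-- A unit-speed geodesic of `ℍ` through `i` in the direction of `i` is the imaginary axis. -/
lemma geodesic_through_I {w : ℝ → ℍ} (hw : Isometry w) (h0 : w 0 = UpperHalfPlane.I)
    (hd : HasDerivAt (fun s => ((w s : ℍ) : ℂ)) Complex.I 0) (t : ℝ) :
    (w t).re = 0 ∧ (w t).im = Real.exp t := by
  have hX : HasDerivAt (fun s => (w s).re) 0 0 := by
    exact (Complex.reCLM.hasFDerivAt.comp_hasDerivAt (0 : ℝ) hd).congr_deriv (by simp)
  have hY : HasDerivAt (fun s => (w s).im) 1 0 := by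
    exact (Complex.imCLM.hasFDerivAt.comp_hasDerivAt (0 : ℝ) hd).congr_deriv (by simp)
  set a := (w t).re with ha
  set b := (w t).im with hb
  have hb0 : 0 < b := (w t).im_pos
  -- The formula for `cosh` of the distance, where the distance is `|r - t|` by isometry. Its
  -- derivative at `r = 0` determines the height `b`; its value at `r = 0` then forces `a = 0`.
  have key : ∀ r, ((w r).re - a) ^ 2 + ((w r).im - b) ^ 2 =
      2 * (w r).im * b * (Real.cosh (r - t) - 1) := by
    intro r
    have h1 := cosh_dist (w r) (w t)
    rw [hw.dist_eq, Real.dist_eq, Real.cosh_abs] at h1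
    have h2 : dist ((w r : ℍ) : ℂ) (w t) ^ 2 = ((w r).re - a) ^ 2 + ((w r).im - b) ^ 2 := by
      rw [Complex.dist_eq, ← Complex.normSq_eq_norm_sq, Complex.normSq_apply]
      simp [ha, hb]; ring
    rw [h1, h2]
    have : (w r).im ≠ 0 := (w r).im_pos.ne'
    field_simp
    ring
  have hk0 := key 0
  have hre : (w 0).re = 0 := by rw [h0]; simp
  have him : (w 0).im = 1 := by rw [h0]; simp
  rw [hre, him] at hk0
  have hL : HasDerivAt (fun r => ((w r).re - a) ^ 2 + ((w r).im - b) ^ 2) (2 * (1 - b)) 0 := by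
    refine (((hX.sub_const a).pow 2).add ((hY.sub_const b).pow 2)).congr_deriv ?_
    simp [him]
  have hR : HasDerivAt (fun r => 2 * (w r).im * b * (Real.cosh (r - t) - 1))
      (2 * b * (Real.cosh (0 - t) - 1) + 2 * b * Real.sinh (0 - t)) 0 := by
    have hc : HasDerivAt (fun r => Real.cosh (r - t) - 1) (Real.sinh (0 - t)) 0 := by
      simpa using (((hasDerivAt_id (0 : ℝ)).sub_const t).cosh).sub_const 1
    refine (((hY.const_mul 2).mul_const b).mul hc).congr_deriv ?_
    rw [him]; ring
  have heq := hL.unique (by simpa only [← key] using hR)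
  have hexp : Real.cosh (0 - t) + Real.sinh (0 - t) = Real.exp (-t) := by
    rw [Real.cosh_add_sinh]; simp
  have hbe : b * Real.exp (-t) = 1 := by rw [← hexp]; linarith
  have hbt : b = Real.exp t := by
    rw [Real.exp_neg] at hbe
    field_simp at hbe
    exact hbe
  refine ⟨?_, hbt⟩
  have hcosh : 2 * b * Real.cosh (0 - t) = b ^ 2 + 1 := by
    rw [Real.cosh_eq, zero_sub, neg_neg]
    nlinarith [hbe, hbt]
  have : a ^ 2 = 0 := by nlinarith
  exact pow_eq_zero_iff two_ne_zero |>.1 this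

lemma den_diagMatrix (t : ℝ) (z : ℍ) : den (diagMatrix t) z = (Real.exp (-(t / 2)) : ℂ) := by
  simp [den]

lemma diagMatrix_smul_I (t : ℝ) :
    ((diagMatrix t • UpperHalfPlane.I : ℍ) : ℂ) = Complex.I * (Real.exp t : ℂ) := by
  rw [coe_smul_eq, den_diagMatrix]
  have h : (Real.exp t : ℂ) = Real.exp (t / 2) * Real.exp (t / 2) := by
    rw [← Complex.ofReal_mul, ← Real.exp_add, add_halves]
  rw [Real.exp_neg, h]
  simp
  ring

/-- An orbit of the geodesic flow on `T¹ℍ` is given by right translations by `a_t`. -/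
lemma IsGeodesicLine.eq_smul {v : ℝ → UnitTangent} (hv : IsGeodesicLine v) {A : SL(2, ℝ)}
    (h0 : v 0 = A • upward) (t : ℝ) : v t = (A * diagMatrix t) • upward := by
  have hbase : ∀ t, (v t).base = (A * diagMatrix t) • UpperHalfPlane.I := by
    intro t
    have hw : Isometry (fun s => A⁻¹ • (v s).base) := (isometry_smul ℍ A⁻¹).comp hv.1
    have h1 : A⁻¹ • v 0 = upward := by rw [h0, inv_smul_smul]
    have hw0 : A⁻¹ • (v 0).base = UpperHalfPlane.I := congrArg UnitTangent.base h1
    have hd := hasDerivAt_smul A⁻¹ (hv.2 0)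
    have hvec : (v 0).vec / den A⁻¹ (v 0).base ^ 2 = Complex.I := congrArg UnitTangent.vec h1
    rw [hvec] at hd
    obtain ⟨hre, him⟩ := geodesic_through_I hw hw0 hd t
    rw [mul_smul, ← inv_smul_eq_iff]
    apply UpperHalfPlane.ext
    rw [diagMatrix_smul_I]
    apply Complex.ext
    · simpa using hre
    · rw [Complex.I_mul_im, Complex.ofReal_re]
      exact him
  apply UnitTangent.ext
  · exact hbase t
  · have h1 := hv.2 t
    simp only [hbase] at h1
    have h2 : HasDerivAt (fun s => ((diagMatrix s • UpperHalfPlane.I : ℍ) : ℂ))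
        (Complex.I * (Real.exp t : ℂ)) t := by
      simp only [diagMatrix_smul_I]
      exact ((Real.hasDerivAt_exp t).ofReal_comp).const_mul _
    have h3 := hasDerivAt_smul A h2
    simp only [← mul_smul] at h3
    rw [h1.unique h3, smul_vec, upward_base, upward_vec, den_mul, den_diagMatrix]
    have h : (Real.exp t : ℂ) = Real.exp (t / 2) * Real.exp (t / 2) := by
      rw [← Complex.ofReal_mul, ← Real.exp_add, add_halves]
    rw [h, Real.exp_neg]
    have := den_ne_zero A (diagMatrix t • UpperHalfPlane.I)
    have h5 : (Real.exp (t / 2) : ℂ) ≠ 0 := by exact_mod_cast (Real.exp_pos _).ne'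
    push_cast
    push_cast at h5
    field_simp

/-- The stabilizer of `i`. -/
lemma eq_rotation_of_smul_I {D : SL(2, ℝ)} (h : D • UpperHalfPlane.I = UpperHalfPlane.I) :
    ∃ (c s : ℝ) (hcs : c ^ 2 + s ^ 2 = 1), D = rotation c s hcs := by
  have h1 := congrArg (fun z : ℍ => (z : ℂ)) h
  simp only [coe_smul_eq] at h1
  rw [div_eq_iff (den_ne_zero _ _)] at h1
  have hr := congrArg Complex.re h1
  have hi := congrArg Complex.im h1
  simp [den] at hr hi
  have hd := sl2_det D
  rw [hr, hi] at hd
  refine ⟨D 1 1, -D 1 0, by linarith, ?_⟩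
  apply sl2_ext <;> simp [hr, hi]

lemma den_rotation_I (c s : ℝ) (h) : den (rotation c s h) UpperHalfPlane.I = c - s * Complex.I := by
  simp [den]; ring

lemma I_div_sq {c s : ℝ} (h : c ^ 2 + s ^ 2 = 1) :
    Complex.I / (c - s * Complex.I) ^ 2 =
      ((-(2 * c * s) : ℝ) : ℂ) + ((c ^ 2 - s ^ 2 : ℝ) : ℂ) * Complex.I := by
  have hne : (c - s * Complex.I : ℂ) ≠ 0 := by
    intro h0
    have h1 := congrArg Complex.re h0
    have h2 := congrArg Complex.im h0
    simp at h1 h2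
    rw [h1, h2] at h
    norm_num at h
  rw [div_eq_iff (pow_ne_zero 2 hne)]
  have h' : (c : ℂ) ^ 2 + (s : ℂ) ^ 2 = 1 := by exact_mod_cast h
  push_cast
  have hI := Complex.I_sq
  linear_combination (-Complex.I * (c ^ 2 + s ^ 2 + 1)) * h' + ((2 * c * s -
    (c ^ 2 - s ^ 2) * Complex.I) * s ^ 2 + (c ^ 2 - s ^ 2) * (2 * c * s)) * hI

/-- PSL(2,ℝ) acts freely on unit vectors: a rotation in the stabilizer of `i` turns vectors by twice
its matrix angle, so fixing the upward vector leaves only `±1`. -/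
lemma eq_of_smul_upward {A B : SL(2, ℝ)} (h : A • upward = B • upward) : proj A = proj B := by
  have h1 : (A⁻¹ * B) • upward = upward := by rw [mul_smul, ← h, inv_smul_smul]
  obtain ⟨c, s, hcs, hD⟩ := eq_rotation_of_smul_I (congrArg UnitTangent.base h1)
  have hv := congrArg UnitTangent.vec h1
  rw [hD, smul_vec, upward_base, upward_vec, den_rotation_I, I_div_sq hcs] at hv
  have hi := congrArg Complex.im hv
  simp [-Complex.ofReal_pow, -Complex.ofReal_sub] at hi
  have hs : s = 0 := by nlinarith
  have hc : (c - 1) * (c + 1) = 0 := by rw [hs] at hcs; linear_combination hcs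
  rw [proj_eq_iff]
  rcases mul_eq_zero.1 hc with hc | hc
  · left
    have : rotation c s hcs = 1 := by
      apply sl2_ext <;> simp [hs, sub_eq_zero.1 hc]
    rw [this] at hD
    rw [← mul_inv_cancel_left A B, hD, mul_one]
  · right
    have : rotation c s hcs = -1 := by
      apply sl2_ext <;> simp [hs, eq_neg_of_add_eq_zero_left hc]
    rw [this] at hD
    rw [← mul_inv_cancel_left A B, hD, mul_neg, mul_one]

lemma exists_of_mk_eq {Γ : Subgroup G} {v w : UnitTangent} (h : TX.mk Γ v = TX.mk Γ w) :
    ∃ C : SL(2, ℝ), proj C ∈ Γ ∧ v = C • w := by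
  obtain ⟨C, hC⟩ := MulAction.orbitRel_apply.1 (Quotient.exact h)
  exact ⟨C, C.2, hC.symm⟩

/-- Two vectors with the same base point that make the angle `θ` differ by a rotation. -/
lemma MeetAtAngle.exists_rotation {Γ : Subgroup G} {A B : SL(2, ℝ)} {θ : ℝ}
    (h : MeetAtAngle Γ (TX.mk Γ (A • upward)) (TX.mk Γ (B • upward)) θ) :
    ∃ (C : SL(2, ℝ)) (c s : ℝ) (hcs : c ^ 2 + s ^ 2 = 1), proj C ∈ Γ ∧
      C * B = A * rotation c s hcs ∧ c ^ 2 - s ^ 2 = Real.cos θ := by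
  obtain ⟨v, w, hv, hw, hbase, hang⟩ := h
  obtain ⟨C₁, hC₁, rfl⟩ := exists_of_mk_eq hv
  obtain ⟨C₂, hC₂, rfl⟩ := exists_of_mk_eq hw
  obtain ⟨c, s, hcs, hD⟩ := eq_rotation_of_smul_I (D := (C₁ * A)⁻¹ * (C₂ * B)) (by
    have h1 : C₁ • A • UpperHalfPlane.I = C₂ • B • UpperHalfPlane.I := hbase
    rw [mul_smul, mul_smul, ← h1, ← mul_smul C₁, inv_smul_smul])
  have hD' : C₂ * B = C₁ * A * rotation c s hcs := by rw [← hD, mul_inv_cancel_left]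
  refine ⟨C₁⁻¹ * C₂, c, s, hcs, ?_, ?_, ?_⟩
  · rw [map_mul, map_inv]; exact Γ.mul_mem (Γ.inv_mem hC₁) hC₂
  · rw [mul_assoc, hD', mul_assoc, inv_mul_cancel_left]
  · have e1 : C₁ • A • upward = (C₁ * A) • upward := (mul_smul _ _ _).symm
    have e2 : C₂ • B • upward = (C₁ * A) • rotation c s hcs • upward := by
      rw [← mul_smul, ← mul_smul, hD']
    rw [e1, e2] at hang
    have hb : rotation c s hcs • UpperHalfPlane.I = UpperHalfPlane.I := by
      apply UpperHalfPlane.ext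
      rw [coe_smul_eq, div_eq_iff (den_ne_zero _ _), den_rotation_I]
      simp
      linear_combination (s : ℂ) * Complex.I_sq
    rw [smul_vec, smul_vec, smul_vec, smul_base, upward_base, hb, upward_vec, den_rotation_I,
      I_div_sq hcs] at hang
    set k := den (C₁ * A) UpperHalfPlane.I ^ 2 with hk
    have hk0 : k ≠ 0 := pow_ne_zero 2 (den_ne_zero _ _)
    rw [div_eq_mul_inv, div_eq_mul_inv, mul_comm, mul_comm _ k⁻¹,
      Complex.angle_mul_left (inv_ne_zero hk0)] at hang
    rw [← hang, InnerProductGeometry.cos_angle]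
    have hn : ‖((-(2 * c * s) : ℝ) : ℂ) + ((c ^ 2 - s ^ 2 : ℝ) : ℂ) * Complex.I‖ = 1 := by
      rw [Complex.norm_add_mul_I, Real.sqrt_eq_one]
      linear_combination (c ^ 2 + s ^ 2 + 1) * hcs
    rw [hn, Complex.inner]
    simp [-Complex.ofReal_pow, -Complex.ofReal_sub]

/-! ### The flow on `X` -/

@[simp] lemma flow_pt (Γ : Subgroup G) (t : ℝ) (g : G) :
    flow Γ t (pt Γ g) = pt Γ (g * proj (diagMatrix t)) := rfl

@[simp] lemma timeReversal_pt (Γ : Subgroup G) (g : G) :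
    timeReversal Γ (pt Γ g) = pt Γ (g * proj reversalMatrix) := rfl

@[simp] lemma toTX_pt (Γ : Subgroup G) (A : SL(2, ℝ)) :
    toTX Γ (pt Γ (proj A)) = TX.mk Γ (A • upward) := rfl

lemma pt_surjective (Γ : Subgroup G) (x : X Γ) : ∃ g, pt Γ g = x := Quotient.exists_rep x

lemma pt_eq_iff {Γ : Subgroup G} {g h : G} : pt Γ g = pt Γ h ↔ ∃ γ ∈ Γ, h = γ * g := by
  constructor
  · intro hgh
    exact ⟨h * g⁻¹, QuotientGroup.rightRel_apply.1 (Quotient.exact hgh), by simp⟩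
  · rintro ⟨γ, hγ, rfl⟩
    exact Quotient.sound (QuotientGroup.rightRel_apply.2 (by simpa using hγ))

lemma pt_mul_right {Γ : Subgroup G} {g h : G} (hgh : pt Γ g = pt Γ h) (k : G) :
    pt Γ (g * k) = pt Γ (h * k) := by
  obtain ⟨γ, hγ, rfl⟩ := pt_eq_iff.1 hgh
  exact pt_eq_iff.2 ⟨γ, hγ, by rw [mul_assoc]⟩

lemma proj_diag_add (s t : ℝ) :
    proj (diagMatrix (s + t)) = proj (diagMatrix s) * proj (diagMatrix t) := by
  rw [diagMatrix_add, map_mul]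

lemma flow_add (Γ : Subgroup G) (s t : ℝ) (x : X Γ) :
    flow Γ (s + t) x = flow Γ t (flow Γ s x) := by
  obtain ⟨g, rfl⟩ := pt_surjective Γ x
  simp [proj_diag_add, mul_assoc]

@[simp] lemma flow_zero (Γ : Subgroup G) (x : X Γ) : flow Γ 0 x = x := by
  obtain ⟨g, rfl⟩ := pt_surjective Γ x
  simp

lemma proj_diag_mul_reversal (t : ℝ) : proj (diagMatrix t) * proj reversalMatrix =
    proj reversalMatrix * proj (diagMatrix (-t)) := by
  rw [← map_mul, diagMatrix_mul_reversal, map_mul]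

lemma flow_timeReversal (Γ : Subgroup G) (t : ℝ) (x : X Γ) :
    flow Γ t (timeReversal Γ x) = timeReversal Γ (flow Γ (-t) x) := by
  obtain ⟨g, rfl⟩ := pt_surjective Γ x
  simp [mul_assoc, proj_diag_mul_reversal]

/-- A lift of a geodesic orbit. -/
lemma IsGeodesicOrbit.exists_lift {Γ : Subgroup G} {p : ℝ → TX Γ} (hp : IsGeodesicOrbit Γ p)
    {x : X Γ} (hx : toTX Γ x = p 0) :
    ∃ A : SL(2, ℝ), pt Γ (proj A) = x ∧ ∀ t, p t = TX.mk Γ ((A * diagMatrix t) • upward) := by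
  obtain ⟨v, hv, hpv⟩ := hp
  obtain ⟨g, rfl⟩ := pt_surjective Γ x
  obtain ⟨A, rfl⟩ := proj_surjective g
  rw [hpv, toTX_pt] at hx
  obtain ⟨C, hC, hCv⟩ := exists_of_mk_eq hx.symm
  refine ⟨C * A, ?_, fun t => ?_⟩
  · exact (pt_eq_iff.2 ⟨proj C, hC, by rw [map_mul]⟩).symm
  · rw [hpv, hv.eq_smul (A := C * A) (by rw [hCv, mul_smul])]

/-- The lift of a periodic geodesic orbit is periodic up to the deck group. -/
lemma flow_eq_self_of_periodic {Γ : Subgroup G} {A : SL(2, ℝ)} {T : ℝ}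
    (h : TX.mk Γ ((A * diagMatrix T) • upward) = TX.mk Γ ((A * diagMatrix 0) • upward)) :
    flow Γ T (pt Γ (proj A)) = pt Γ (proj A) := by
  obtain ⟨C, hC, hCv⟩ := exists_of_mk_eq h
  rw [← mul_smul] at hCv
  have := eq_of_smul_upward hCv
  rw [flow_pt, ← map_mul, this]
  simpa using (pt_eq_iff.2 ⟨proj C, hC, by simp⟩).symm

/-- At a crossing of angle `θ`, the reversed outgoing vector is the rotation of the incoming one
by an angle `±(π - θ)`. -/
lemma CrossesItself.exists_rotation {Γ : Subgroup G} {p : ℝ → TX Γ} {A : SL(2, ℝ)}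
    (hp : ∀ t, p t = TX.mk Γ ((A * diagMatrix t) • upward)) {τ L θ : ℝ}
    (h : CrossesItself Γ p τ L θ) :
    ∃ (c s : ℝ) (hcs : c ^ 2 + s ^ 2 = 1), 0 < c ∧ s ^ 2 = Real.sin ((Real.pi - θ) / 2) ^ 2 ∧
      ∃ γ ∈ Γ, γ * proj (A * diagMatrix τ * diagMatrix L) =
        proj (A * diagMatrix τ * (rotation c s hcs * reversalMatrix)) := by
  obtain ⟨hL, hθ0, hθπ, hm⟩ := h
  rw [hp, hp, diagMatrix_add, ← mul_assoc] at hm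
  obtain ⟨C, c, s, hcs, hC, hCeq, hcos⟩ := hm.exists_rotation
  have hs2 : s ^ 2 = (1 - Real.cos θ) / 2 := by linarith
  have hc2 : c ^ 2 = (1 + Real.cos θ) / 2 := by linarith
  have hcos1 : Real.cos θ < 1 := by
    rw [← Real.cos_zero]
    exact Real.cos_lt_cos_of_nonneg_of_le_pi le_rfl hθπ.le hθ0
  have hs0 : s ≠ 0 := by
    rintro rfl
    linarith
  have hsin : Real.sin ((Real.pi - θ) / 2) ^ 2 = (1 + Real.cos θ) / 2 := by
    rw [show (Real.pi - θ) / 2 = Real.pi / 2 - θ / 2 by ring, Real.sin_pi_div_two_sub,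
      Real.cos_sq, mul_div_cancel₀ _ two_ne_zero]
    ring
  have hγ : proj C * proj (A * diagMatrix τ * diagMatrix L) =
      proj (A * diagMatrix τ) * proj (rotation c s hcs) := by
    rw [← map_mul, hCeq, map_mul]
  -- Splitting off `d_π` exchanges the roles of `c` and `s` up to sign. The sign is free in PSL(2,ℝ)
  -- and is chosen to make the new cosine positive.
  rcases lt_or_gt_of_ne hs0 with hs | hs
  · refine ⟨-s, c, by linarith, by linarith, by rw [hsin, hc2], proj C, hC, ?_⟩
    have hrot : rotation (-s) c (by linarith) * reversalMatrix = -rotation c s hcs := by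
      apply sl2_ext <;> simp [mul_apply_two]
    rw [hγ, hrot, ← map_mul, mul_neg, proj_neg]
  · refine ⟨s, -c, by linarith, hs, by rw [neg_sq, hsin, hc2], proj C, hC, ?_⟩
    have hrot : rotation s (-c) (by linarith) * reversalMatrix = rotation c s hcs := by
      apply sl2_ext <;> simp [mul_apply_two]
    rw [hγ, hrot, ← map_mul]

/-- The loop at a crossing is long if the angle is close to `π`. -/
lemma exp_neg_lt_of_isHyperbolic {Γ : Subgroup G} (hΓ : ∀ γ ∈ Γ, γ ≠ 1 → IsHyperbolic γ)
    {B : SL(2, ℝ)} {c s L : ℝ} (hcs : c ^ 2 + s ^ 2 = 1) (hL : 0 < L) {γ : G} (hγ : γ ∈ Γ)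
    (h : γ * proj (B * diagMatrix L) = proj (B * (rotation c s hcs * reversalMatrix))) :
    Real.exp (-L) < s ^ 2 := by
  have hE : 1 < Real.exp (L / 2) := Real.one_lt_exp_iff.2 (by linarith)
  have hs1 : |s| ≤ 1 := by
    rw [← Real.sqrt_sq_eq_abs]
    exact Real.sqrt_le_one.2 (by nlinarith [sq_nonneg c])
  -- For trivial `γ` the upper left entries would give `|s| = e^{L/2} > 1`.
  have hne : γ ≠ 1 := by
    rintro rfl
    rw [one_mul, map_mul, map_mul, mul_right_inj, proj_eq_iff] at h
    have habs : |s| = Real.exp (L / 2) := by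
      rcases h with h | h
      · have := congrArg (fun M : SL(2, ℝ) => M 0 0) h
        simp [mul_apply_two] at this
        rw [← abs_neg, this, abs_of_pos (Real.exp_pos _)]
      · have := congrArg (fun M : SL(2, ℝ) => M 0 0) h
        simp [mul_apply_two] at this
        rw [this, abs_of_pos (Real.exp_pos _)]
    linarith
  have hγeq : proj (B * (rotation c s hcs * reversalMatrix * diagMatrix (-L)) * B⁻¹) = γ := by
    rw [← mul_assoc, map_mul, map_mul, ← h, diagMatrix_neg, map_mul, map_inv, map_inv]
    group
  have htr := hΓ γ hγ hne _ hγeq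
  have htr2 : ((B * (rotation c s hcs * reversalMatrix * diagMatrix (-L)) * B⁻¹ : SL(2, ℝ)) :
      Matrix (Fin 2) (Fin 2) ℝ).trace = -s * (Real.exp (L / 2) + Real.exp (-(L / 2))) := by
    rw [Matrix.SpecialLinearGroup.coe_mul, Matrix.SpecialLinearGroup.coe_mul,
      Matrix.trace_mul_comm, ← Matrix.mul_assoc, ← Matrix.SpecialLinearGroup.coe_mul,
      inv_mul_cancel, Matrix.SpecialLinearGroup.coe_one, Matrix.one_mul, Matrix.trace_fin_two]
    rw [mul_apply_two, mul_apply_two]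
    simp [mul_apply_two]
    ring_nf
  rw [htr2, abs_mul, abs_neg, abs_of_pos (a := Real.exp (L / 2) + _) (by positivity)] at htr
  have hE' : Real.exp (-(L / 2)) < Real.exp (L / 2) := Real.exp_lt_exp.2 (by linarith)
  have h1 : 1 < |s| * Real.exp (L / 2) := by
    nlinarith [abs_nonneg s]
  have h2 : Real.exp (-(L / 2)) < |s| := by
    rw [Real.exp_neg, inv_lt_iff_one_lt_mul₀ (Real.exp_pos _)]
    exact h1
  calc Real.exp (-L) = Real.exp (-(L / 2)) ^ 2 := by
        rw [← Real.exp_nat_mul]; congr 1; push_cast; ring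
    _ < |s| ^ 2 := by
        have := Real.exp_pos (-(L / 2))
        nlinarith
    _ = s ^ 2 := sq_abs s

/-- At a crossing, the reversed loop starts in the rotated incoming direction. -/
lemma pt_crossing {Γ : Subgroup G} {B B' R : SL(2, ℝ)} {γ : G} (hγ : γ ∈ Γ)
    (h : γ * proj B' = proj (B * (R * reversalMatrix))) (k : G) :
    pt Γ (proj B * proj R * k) = pt Γ (proj B' * proj reversalMatrix * k) := by
  refine (pt_eq_iff.2 ⟨γ, hγ, ?_⟩).symm
  rw [← mul_assoc, ← mul_assoc, h, map_mul, map_mul]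
  simp only [mul_assoc,
    proj_reversal_mul_self, one_mul]

/-! ### Fixed points of broken geodesics -/

/-- The action of the inverse of the rotation with first row `(c, s)` on slopes. -/
def rotateSlope (c s y : ℝ) : ℝ := (c * y - s) / (c + s * y)

/-- The rotation with first row `(c, s)` is by a small angle, with `|sin| ≤ σ`. -/
structure SmallAngle (σ c s : ℝ) : Prop where
  sq_add_sq : c ^ 2 + s ^ 2 = 1
  pos : 0 < c
  abs_le : |s| ≤ σ
  le_sixth : σ ≤ 1 / 6

namespace SmallAngle

variable {σ c s : ℝ}

lemma nonneg (h : SmallAngle σ c s) : 0 ≤ σ := (abs_nonneg _).trans h.abs_le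

lemma le_cos (h : SmallAngle σ c s) : 49 / 50 ≤ c := by
  have h1 := h.sq_add_sq
  have h2 : s ^ 2 ≤ (1 / 6) ^ 2 := by
    rw [← sq_abs]; exact pow_le_pow_left₀ (abs_nonneg _) (h.abs_le.trans h.le_sixth) 2
  nlinarith [h.pos]

lemma cos_le (h : SmallAngle σ c s) : c ≤ 1 := by
  nlinarith [h.pos, h.sq_add_sq, sq_nonneg s]

lemma abs_mul_le (h : SmallAngle σ c s) (y : ℝ) : |s * y| ≤ σ * |y| := by
  rw [abs_mul]; exact mul_le_mul_of_nonneg_right h.abs_le (abs_nonneg _)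

lemma den_ge (h : SmallAngle σ c s) {y η : ℝ} (hy : |y| ≤ η) :
    49 / 50 - σ * η ≤ c + s * y := by
  have h1 := h.abs_mul_le y
  have h2 := neg_abs_le (s * y)
  have h3 := mul_le_mul_of_nonneg_left hy h.nonneg
  linarith [h.le_cos]

lemma den_pos (h : SmallAngle σ c s) {y : ℝ} (hy : |y| ≤ 1) : 0 < c + s * y := by
  have := h.den_ge hy
  have := h.le_sixth
  linarith

lemma abs_rotateSlope_le (h : SmallAngle σ c s) {y η : ℝ} (hy : |y| ≤ η) (hη : η ≤ 1) :
    |rotateSlope c s y| ≤ (η + σ) / (49 / 50 - σ * η) := by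
  have h0 : 0 ≤ η := (abs_nonneg _).trans hy
  have hd : 0 < 49 / 50 - σ * η := by nlinarith [h.le_sixth, h.nonneg]
  rw [rotateSlope, abs_div, abs_of_pos (h.den_pos (hy.trans hη))]
  refine div_le_div₀ (by linarith [h.nonneg]) ?_ hd (h.den_ge hy)
  refine (abs_sub _ _).trans (add_le_add ?_ h.abs_le)
  rw [abs_mul, abs_of_pos h.pos]
  exact (mul_le_of_le_one_left (abs_nonneg _) h.cos_le).trans hy

/-- The first corner after a long segment: the slope arrives with size at most `σ / 6`, and `(7/6) /
(49/50 - 1/216) < 5/4`. -/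
lemma abs_rotateSlope_le_of_le_div (h : SmallAngle σ c s) {y : ℝ} (hy : |y| ≤ σ / 6) :
    |rotateSlope c s y| ≤ 5 / 4 * σ := by
  have h0 := h.nonneg
  have h6 := h.le_sixth
  refine (h.abs_rotateSlope_le hy (by linarith)).trans ?_
  have : σ * (σ / 6) ≤ 1 / 216 := by nlinarith
  rw [div_le_iff₀ (by linarith)]
  nlinarith

/-- The second corner, reached through a segment that may contract hardly at all: `(9/4) / (49/50 -
5/144) < 5/2`. A long segment comes next, so the slopes never grow beyond this. -/
lemma abs_rotateSlope_le_of_le_mul (h : SmallAngle σ c s) {y : ℝ} (hy : |y| ≤ 5 / 4 * σ) :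
    |rotateSlope c s y| ≤ 5 / 2 * σ := by
  have h0 := h.nonneg
  have h6 := h.le_sixth
  refine (h.abs_rotateSlope_le hy (by linarith)).trans ?_
  have : σ * (5 / 4 * σ) ≤ 5 / 144 := by nlinarith
  rw [div_le_iff₀ (by linarith)]
  nlinarith

lemma abs_rotateSlope_le_one (h : SmallAngle σ c s) {y : ℝ} (hy : |y| ≤ 1 / 2) :
    |rotateSlope c s y| ≤ 1 := by
  have h0 := h.nonneg
  have h6 := h.le_sixth
  refine (h.abs_rotateSlope_le hy (by norm_num)).trans ?_
  rw [div_le_one (by linarith)]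
  linarith

lemma continuousOn_rotateSlope (h : SmallAngle σ c s) {f : ℝ → ℝ} {S : Set ℝ}
    (hf : ContinuousOn f S) (hS : ∀ r ∈ S, |f r| ≤ 1) :
    ContinuousOn (fun r => rotateSlope c s (f r)) S := by
  unfold rotateSlope
  refine ContinuousOn.div ?_ ?_ fun r hr => (h.den_pos (hS r hr)).ne'
  · exact (continuousOn_const.mul hf).sub continuousOn_const
  · exact continuousOn_const.add (continuousOn_const.mul hf)

end SmallAngle

lemma abs_mul_le_of_le_one {e r b : ℝ} (he : 0 ≤ e) (he1 : e ≤ 1) (hr : |r| ≤ b) :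
    |e * r| ≤ b := by
  rw [abs_mul, abs_of_nonneg he]
  exact (mul_le_of_le_one_left (abs_nonneg _) he1).trans hr

/-- The slopes of the end points of the axis, seen from the four corners of a closed broken
geodesic two of whose segments are long. -/
lemma exists_slopes {σ c₁ s₁ c₂ s₂ : ℝ} (h₁ : SmallAngle σ c₁ s₁) (h₂ : SmallAngle σ c₂ s₂)
    {ea eb ec ed : ℝ} (ha : 0 ≤ ea) (ha1 : ea ≤ 1) (hb : 0 ≤ eb) (hb1 : eb ≤ σ ^ 2)
    (hc : 0 ≤ ec) (hc1 : ec ≤ 1) (hd : 0 ≤ ed) (hd1 : ed ≤ σ ^ 2) :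
    ∃ ra rb rc rd : ℝ, ra = rotateSlope c₁ s₁ (eb * rb) ∧ rb = rotateSlope c₁ s₁ (ec * rc) ∧
      rc = rotateSlope c₂ s₂ (ed * rd) ∧ rd = rotateSlope c₂ s₂ (ea * ra) ∧
      |ra| ≤ 5 / 2 * σ ∧ |rb| ≤ 5 / 2 * σ ∧ |rc| ≤ 5 / 2 * σ ∧ |rd| ≤ 5 / 2 * σ := by
  have h0 := h₁.nonneg
  have h6 := h₁.le_sixth
  -- The long segments enter here: they contract by `σ ^ 2 ≤ σ / 6`.
  have hshort : ∀ e r : ℝ, 0 ≤ e → e ≤ σ ^ 2 → |r| ≤ 1 → |e * r| ≤ σ / 6 := by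
    intro e r he he1 hr
    rw [abs_mul, abs_of_nonneg he]
    nlinarith [abs_nonneg r]
  set fd : ℝ → ℝ := fun r => rotateSlope c₂ s₂ (ea * r) with hfd
  set fc : ℝ → ℝ := fun r => rotateSlope c₂ s₂ (ed * fd r) with hfc
  set fb : ℝ → ℝ := fun r => rotateSlope c₁ s₁ (ec * fc r) with hfb
  set fa : ℝ → ℝ := fun r => rotateSlope c₁ s₁ (eb * fb r) with hfa
  have hS : ∀ r ∈ Set.Icc (-(1 / 2) : ℝ) (1 / 2), |r| ≤ 1 / 2 := fun r hr => abs_le.2 hr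
  have bd : ∀ r ∈ Set.Icc (-(1 / 2) : ℝ) (1 / 2), |fd r| ≤ 1 := fun r hr =>
    h₂.abs_rotateSlope_le_one (abs_mul_le_of_le_one ha ha1 (hS r hr))
  have bd' : ∀ r ∈ Set.Icc (-(1 / 2) : ℝ) (1 / 2), |ed * fd r| ≤ σ / 6 := fun r hr =>
    hshort _ _ hd hd1 (bd r hr)
  have bc : ∀ r ∈ Set.Icc (-(1 / 2) : ℝ) (1 / 2), |fc r| ≤ 5 / 4 * σ := fun r hr =>
    h₂.abs_rotateSlope_le_of_le_div (bd' r hr)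
  have bc' : ∀ r ∈ Set.Icc (-(1 / 2) : ℝ) (1 / 2), |ec * fc r| ≤ 5 / 4 * σ := fun r hr =>
    abs_mul_le_of_le_one hc hc1 (bc r hr)
  have bb : ∀ r ∈ Set.Icc (-(1 / 2) : ℝ) (1 / 2), |fb r| ≤ 5 / 2 * σ := fun r hr =>
    h₁.abs_rotateSlope_le_of_le_mul (bc' r hr)
  have bb' : ∀ r ∈ Set.Icc (-(1 / 2) : ℝ) (1 / 2), |eb * fb r| ≤ σ / 6 := fun r hr =>
    hshort _ _ hb hb1 ((bb r hr).trans (by linarith))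
  have ba : ∀ r ∈ Set.Icc (-(1 / 2) : ℝ) (1 / 2), |fa r| ≤ 5 / 4 * σ := fun r hr =>
    h₁.abs_rotateSlope_le_of_le_div (bb' r hr)
  have cd : ContinuousOn fd (Set.Icc (-(1 / 2)) (1 / 2)) :=
    h₂.continuousOn_rotateSlope (by fun_prop) fun r hr =>
      abs_mul_le_of_le_one ha ha1 ((hS r hr).trans (by norm_num))
  have cc : ContinuousOn fc (Set.Icc (-(1 / 2)) (1 / 2)) :=
    h₂.continuousOn_rotateSlope (continuousOn_const.mul cd) fun r hr =>
      (bd' r hr).trans (by linarith)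
  have cb : ContinuousOn fb (Set.Icc (-(1 / 2)) (1 / 2)) :=
    h₁.continuousOn_rotateSlope (continuousOn_const.mul cc) fun r hr =>
      (bc' r hr).trans (by linarith)
  have ca : ContinuousOn fa (Set.Icc (-(1 / 2)) (1 / 2)) :=
    h₁.continuousOn_rotateSlope (continuousOn_const.mul cb) fun r hr =>
      (bb' r hr).trans (by linarith)
  -- A continuous self-map of an interval has a fixed point; no contraction estimate is needed.
  obtain ⟨r, hr, hfix⟩ := exists_mem_Icc_isFixedPt_of_mapsTo ca (by norm_num) (fun r hr =>
    abs_le.1 ((ba r hr).trans (by linarith)))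
  have hra : |r| ≤ 5 / 4 * σ := by
    have := ba r hr
    rwa [hfix] at this
  exact ⟨r, fb r, fc r, fd r, hfix.symm, rfl, rfl, rfl, hra.trans (by linarith), bb r hr,
    (bc r hr).trans (by linarith),
    h₂.abs_rotateSlope_le_of_le_mul (abs_mul_le_of_le_one ha ha1 hra)⟩

lemma sl2_ext_of_ne_zero {A B : SL(2, ℝ)} (h : A 0 0 ≠ 0) (h00 : A 0 0 = B 0 0)
    (h01 : A 0 1 = B 0 1) (h10 : A 1 0 = B 1 0) : A = B := by
  refine sl2_ext h00 h01 h10 ?_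
  have hA := sl2_det A
  have hB := sl2_det B
  rw [← h00, ← h01, ← h10] at hB
  exact mul_left_cancel₀ h (by linarith)

/-- The frame on the axis with the end points `x` and `1 / y`. -/
def axisFrame (x y : ℝ) : SL(2, ℝ) := lowerUnipotent y * upperUnipotent (x / (1 - x * y))

/-- Transport of the axis along a segment of length `T` and the corner after it. -/
lemma diag_mul_rotation_mul_axisFrame {c s : ℝ} (hcs : c ^ 2 + s ^ 2 = 1) {T x y' : ℝ}
    (hK : 0 < c + s * y') (hD : c + s * (Real.exp (-T) * x) ≠ 0)
    (hxy : 1 - x * (Real.exp (-T) * rotateSlope c s y') ≠ 0) :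
    diagMatrix T * rotation c s hcs * axisFrame (rotateSlope c s (Real.exp (-T) * x)) y' =
      axisFrame x (Real.exp (-T) * rotateSlope c s y') *
        diagMatrix (T + 2 * Real.log (c + s * y')) := by
  set E := Real.exp (T / 2) with hE
  have hE0 : 0 < E := Real.exp_pos _
  have h1 : Real.exp (-T) = (E ^ 2)⁻¹ := by
    rw [hE, ← Real.exp_nat_mul, ← Real.exp_neg]; congr 1; push_cast; ring
  have h2 : Real.exp ((T + 2 * Real.log (c + s * y')) / 2) = E * (c + s * y') := by
    rw [add_div, mul_div_cancel_left₀ _ two_ne_zero, Real.exp_add, Real.exp_log hK]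
  have h3 : Real.exp (-((T + 2 * Real.log (c + s * y')) / 2)) = (E * (c + s * y'))⁻¹ := by
    rw [Real.exp_neg, h2]
  set K := c + s * y' with hKdef
  have hW : 1 - x * (Real.exp (-T) * rotateSlope c s y') =
      (K * E ^ 2 + x * (s - c * y')) / (K * E ^ 2) := by
    rw [rotateSlope, h1, ← hKdef]; field_simp; ring
  have hDE : c * E ^ 2 + s * x ≠ 0 := by
    intro h
    apply hD
    rw [h1]; field_simp; linarith
  have hx' : rotateSlope c s (Real.exp (-T) * x) = (c * x - s * E ^ 2) / (c * E ^ 2 + s * x) := by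
    rw [rotateSlope, h1]
    rw [h1] at hD
    rw [div_eq_div_iff hD hDE]
    field_simp
  have hW' : 1 - rotateSlope c s (Real.exp (-T) * x) * y' =
      (K * E ^ 2 + x * (s - c * y')) / (c * E ^ 2 + s * x) := by
    rw [hx', hKdef, eq_div_iff hDE, sub_mul, mul_right_comm, div_mul_cancel₀ _ hDE]; ring
  have hW0 : K * E ^ 2 + x * (s - c * y') ≠ 0 := by
    intro h
    rw [hW, h, zero_div] at hxy
    exact hxy rfl
  have hP : x / (1 - x * (Real.exp (-T) * rotateSlope c s y')) =
      x * (K * E ^ 2) / (K * E ^ 2 + x * (s - c * y')) := by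
    rw [hW, div_div_eq_mul_div]
  have hP' : rotateSlope c s (Real.exp (-T) * x) / (1 - rotateSlope c s (Real.exp (-T) * x) * y') =
      (c * x - s * E ^ 2) / (K * E ^ 2 + x * (s - c * y')) := by
    rw [hW', hx', div_div_div_cancel_right₀ hDE]
  have hE' : Real.exp (-(T / 2)) = E⁻¹ := Real.exp_neg _
  have hy : Real.exp (-T) * rotateSlope c s y' = (c * y' - s) / (K * E ^ 2) := by
    rw [rotateSlope, h1, ← hKdef]; field_simp
  rw [axisFrame, axisFrame, hP, hP', hy]
  generalize T + 2 * Real.log K = τ at h2 h3 ⊢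
  -- The columns of `axisFrame x y` are multiples of `(x, 1)` and `(1, y)`, the two end points. Both
  -- sides have the same end points, so they can differ only by a diagonal factor. The first column
  -- on the left is `E * K` times `(1, y)`, and `E * K` is the exponential of half the new time.
  apply sl2_ext_of_ne_zero
  · simp only [mul_apply_two]
    simp [← hE]
    intro h
    exact (mul_pos hE0 hK).ne' (by rw [hKdef]; linarith)
  · simp [mul_apply_two, ← hE, h2, hKdef]
    ring
  · simp [mul_apply_two, ← hE, h3]
    generalize hWd : K * E ^ 2 + x * (s - c * y') = W at hW0 ⊢
    field_simp
    rw [← hWd, hKdef]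
    linear_combination x * hcs
  · simp [mul_apply_two, h2, hE']
    field_simp
    ring

/-! ### Existence of the partner orbit -/

lemma distX_le (Γ : Subgroup G) (g h : G) : distX Γ (pt Γ g) (pt Γ h) ≤ distG g h :=
  csInf_le ⟨0, by rintro _ ⟨g₁, g₂, -, -, rfl⟩; exact distG_nonneg _ _⟩ ⟨g, h, rfl, rfl, rfl⟩

/-- Conjugation by `a_t` expands the lower unipotent factor and contracts the upper one. The left
factor `diagMatrix t` is the point of the segment, so what follows it is the deviation of the axis.
-/
lemma axisFrame_mul_diagMatrix (x y t z : ℝ) :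
    axisFrame x y * diagMatrix (t + z) =
      diagMatrix t * lowerUpperDiag (y * Real.exp t) (x / (1 - x * y) * Real.exp (-t)) z := by
  have h1 : Real.exp t = Real.exp (t / 2) * Real.exp (t / 2) := by
    rw [← Real.exp_add, add_halves]
  rw [diagMatrix_add, lowerUpperDiag, ← mul_assoc, ← mul_assoc]
  congr 1
  have hE : Real.exp (t / 2) ≠ 0 := (Real.exp_pos _).ne'
  apply sl2_ext <;> simp [axisFrame, mul_apply_two, Real.exp_neg, h1] <;> field_simp

/-- The deviation is O(σ) on the whole segment: `q` is largest at its end, where it equals `r`, and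
`p` at its start. The constants combine as `2 · (5/2) · (31/60) + 4 + 3 · 7 < 36`. -/
lemma axis_bound {σ x r T t z : ℝ} (hσ : 0 < σ) (h6 : σ ≤ 1 / 6) (hx : |x| ≤ 5 / 2 * σ)
    (hr : |r| ≤ 5 / 2 * σ) (ht : t ∈ Set.Icc 0 T) (hz : |z| ≤ 4 * σ) :
    let y := Real.exp (-T) * r
    let q := y * Real.exp t
    let p := x / (1 - x * y) * Real.exp (-t)
    2 * |q| * |p| + |z| + Real.exp |z| * (|p| + |q| * p ^ 2 + |q|) < 36 * σ := by
  intro y q p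
  have hq : |q| ≤ 5 / 2 * σ := by
    have : q = Real.exp (t - T) * r := by
      simp only [q, y]; rw [sub_eq_add_neg, Real.exp_add]; ring
    rw [this]
    exact abs_mul_le_of_le_one (Real.exp_pos _).le (Real.exp_le_one_iff.2 (by linarith [ht.2])) hr
  have hy : |y| ≤ 5 / 2 * σ :=
    abs_mul_le_of_le_one (Real.exp_pos _).le
      (Real.exp_le_one_iff.2 (by linarith [ht.1, ht.2])) hr
  have hxy : |x * y| ≤ 25 / 144 := by
    rw [abs_mul]
    calc |x| * |y| ≤ (5 / 2 * σ) * (5 / 2 * σ) :=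
          mul_le_mul hx hy (abs_nonneg _) (by positivity)
      _ ≤ _ := by nlinarith
  have hden : 119 / 144 ≤ 1 - x * y := by linarith [le_abs_self (x * y)]
  have hp : |p| ≤ 31 / 10 * σ := by
    have h1 : |x / (1 - x * y)| ≤ 31 / 10 * σ := by
      rw [abs_div, abs_of_pos (a := 1 - x * y) (by linarith), div_le_iff₀ (by linarith)]
      nlinarith
    simp only [p]
    rw [mul_comm]
    exact abs_mul_le_of_le_one (Real.exp_pos _).le
      (Real.exp_le_one_iff.2 (by linarith [ht.1])) h1
  have hexp : Real.exp |z| ≤ 3 := by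
    have h1 : |z| ≤ 2 / 3 := by linarith
    have h2 := Real.exp_bound_div_one_sub_of_interval (abs_nonneg z) (by linarith)
    refine h2.trans ?_
    rw [div_le_iff₀ (by linarith)]
    linarith
  have hp0 := abs_nonneg p
  have hq0 := abs_nonneg q
  have hp1 : |p| ≤ 31 / 60 := by linarith
  have hpsq : p ^ 2 ≤ 1 / 3 := by rw [← sq_abs]; nlinarith
  have e1 : |q| * |p| ≤ 5 / 2 * σ * (31 / 60) := mul_le_mul hq hp1 hp0 (by positivity)
  have e2 : |q| * p ^ 2 ≤ 5 / 2 * σ * (1 / 3) :=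
    mul_le_mul hq hpsq (sq_nonneg _) (by positivity)
  have e3 : |p| + |q| * p ^ 2 + |q| ≤ 7 * σ := by linarith
  have e4 : Real.exp |z| * (|p| + |q| * p ^ 2 + |q|) ≤ 3 * (7 * σ) :=
    mul_le_mul hexp e3 (by positivity) (by norm_num)
  nlinarith

/-- The axis stays close to a segment. -/
lemma distX_flow_axis_lt {Γ : Subgroup G} {σ x r T t z : ℝ} (hσ : 0 < σ) (h6 : σ ≤ 1 / 6)
    (hx : |x| ≤ 5 / 2 * σ) (hr : |r| ≤ 5 / 2 * σ) (ht : t ∈ Set.Icc 0 T) (hz : |z| ≤ 4 * σ)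
    (g : G) :
    distX Γ (flow Γ t (pt Γ g))
      (flow Γ (t + z) (pt Γ (g * proj (axisFrame x (Real.exp (-T) * r))))) < 36 * σ := by
  obtain ⟨A, rfl⟩ := proj_surjective g
  rw [flow_pt, flow_pt, mul_assoc, ← map_mul, ← map_mul, ← map_mul, axisFrame_mul_diagMatrix,
    ← mul_assoc]
  exact (distX_le _ _ _).trans_lt ((distG_mul_lowerUpperDiag_le _ _ _ _).trans_lt
    (axis_bound hσ h6 hx hr ht hz))

lemma distX_timeReversal_flow_axis_lt {Γ : Subgroup G} {σ x r T t z : ℝ} (hσ : 0 < σ)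
    (h6 : σ ≤ 1 / 6) (hx : |x| ≤ 5 / 2 * σ) (hr : |r| ≤ 5 / 2 * σ) (ht : t ∈ Set.Icc 0 T)
    (hz : |z| ≤ 4 * σ) (g : G) :
    distX Γ (timeReversal Γ (flow Γ t (pt Γ g))) (timeReversal Γ
      (flow Γ (t + z) (pt Γ (g * proj (axisFrame x (Real.exp (-T) * r)))))) < 36 * σ := by
  obtain ⟨A, rfl⟩ := proj_surjective g
  rw [flow_pt, flow_pt, timeReversal_pt, timeReversal_pt, ← map_mul, ← map_mul, ← map_mul,
    ← map_mul, ← map_mul, mul_assoc A (axisFrame _ _), axisFrame_mul_diagMatrix,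
    ← mul_assoc A (diagMatrix t)]
  exact (distX_le _ _ _).trans_lt ((distG_mul_lowerUpperDiag_mul_reversal_le _ _ _ _).trans_lt
    (axis_bound hσ h6 hx hr ht hz))

/-! ### Passing the corners with the deck transformations -/

section Loop

variable {Γ : Subgroup G} {g₀ g₁ g₂ R : G} {T' T : ℝ}

/-- By `H`, the end of the stretch turned by `R` is the start of the reversed loop; `hu` transports
the axis frame across that corner. -/
lemma flow_to_loop (h₁ : g₁ = g₀ * proj (diagMatrix T'))
    (H : ∀ k, pt Γ (g₁ * R * k) = pt Γ (g₂ * proj reversalMatrix * k)) {u u' : G} {τ : ℝ}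
    (hu : proj (diagMatrix T') * R * u' = u * proj (diagMatrix τ)) :
    flow Γ τ (pt Γ (g₀ * u)) = pt Γ (g₂ * proj reversalMatrix * u') := by
  rw [← H, flow_pt, mul_assoc, ← hu, h₁]
  simp only [mul_assoc]

/-- The reversed loop runs from `g₂ d_π` to `g₁ d_π`. Turning there by `R`, which commutes with
`d_π`, gives `g₁ R d_π`, and `H` identifies this with `g₂ d_π d_π = g₂`. Hence the same corner
occurs at both ends of the loop. -/
lemma flow_through_loop (h₂ : g₂ = g₁ * proj (diagMatrix T))
    (hR : R * proj reversalMatrix = proj reversalMatrix * R)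
    (H : ∀ k, pt Γ (g₁ * R * k) = pt Γ (g₂ * proj reversalMatrix * k)) {u u' : G} {τ : ℝ}
    (hu : proj (diagMatrix T) * R * u' = u * proj (diagMatrix τ)) :
    flow Γ τ (pt Γ (g₂ * proj reversalMatrix * u)) = pt Γ (g₂ * u') := by
  have h3 : g₂ * proj reversalMatrix * u * proj (diagMatrix τ) =
      g₁ * R * (proj reversalMatrix * u') := by
    calc _ = g₂ * (proj reversalMatrix * proj (diagMatrix T)) * (R * u') := by
          rw [mul_assoc, ← hu]; simp only [mul_assoc]
      _ = g₁ * (proj (diagMatrix T) * proj (diagMatrix (-T))) * (proj reversalMatrix * R) * u' := by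
          rw [← neg_neg T, ← proj_diag_mul_reversal, h₂]; simp only [mul_assoc, neg_neg]
      _ = _ := by
          rw [← proj_diag_add, add_neg_cancel, diagMatrix_zero, map_one, mul_one, ← hR]
          simp only [mul_assoc]
  rw [flow_pt, h3, H]
  congr 1
  rw [mul_assoc, ← mul_assoc (proj reversalMatrix), proj_reversal_mul_self, one_mul]

lemma flow_eq_timeReversal (h₂ : g₂ = g₁ * proj (diagMatrix T)) (t : ℝ) :
    flow Γ t (pt Γ g₁) =
      timeReversal Γ (flow Γ (T - t) (pt Γ (g₂ * proj reversalMatrix))) := by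
  rw [flow_pt, flow_pt, timeReversal_pt, mul_assoc, proj_diag_mul_reversal, mul_assoc,
    ← mul_assoc (proj reversalMatrix), proj_reversal_mul_self, one_mul, h₂, mul_assoc,
    ← proj_diag_add]
  congr 4
  ring

end Loop

/-! ### The time spent on the axis -/

lemma abs_log_one_add_le {z : ℝ} (hz : |z| ≤ 1 / 2) : |Real.log (1 + z)| ≤ 2 * |z| := by
  have h1 : 1 / 2 ≤ 1 + z := by linarith [neg_abs_le z]
  rw [abs_le]
  constructor
  · have h2 := Real.one_sub_inv_le_log_of_pos (x := 1 + z) (by linarith)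
    refine le_trans ?_ h2
    have h3 : 1 - (1 + z)⁻¹ = z / (1 + z) := by
      field_simp; ring
    rw [h3, le_div_iff₀ (by linarith)]
    rcases abs_cases z with h | h <;> nlinarith
  · have h2 := Real.log_le_sub_one_of_pos (x := 1 + z) (by linarith)
    linarith [le_abs_self z, abs_nonneg z]

namespace SmallAngle

variable {σ c s : ℝ}

/-- The perturbation `s (e r)` is at most `(5/2) σ² e`, second order in the angle and exponentially
small in the next segment. This is the source of the error term for the period. -/
lemma abs_log_sub_le (h : SmallAngle σ c s) {e r : ℝ} (he : 0 ≤ e) (he1 : e ≤ 1)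
    (hr : |r| ≤ 5 / 2 * σ) :
    |Real.log (c + s * (e * r)) - Real.log c| ≤ 6 * σ ^ 2 * e := by
  have h0 := h.nonneg
  have h6 := h.le_sixth
  have hc := h.le_cos
  have hmul : |s * (e * r)| ≤ 5 / 2 * σ ^ 2 * e := by
    refine (h.abs_mul_le _).trans ?_
    rw [abs_mul, abs_of_nonneg he]
    calc σ * (e * |r|) ≤ σ * (e * (5 / 2 * σ)) := by gcongr
      _ = _ := by ring
  have hz : |s * (e * r) / c| ≤ 3 * σ ^ 2 * e := by
    rw [abs_div, abs_of_pos h.pos, div_le_iff₀ h.pos]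
    have : 0 ≤ σ ^ 2 * e := by positivity
    nlinarith
  have hz' : |s * (e * r) / c| ≤ 1 / 2 := by
    refine hz.trans ?_
    have : σ ^ 2 * e ≤ σ ^ 2 := mul_le_of_le_one_right (by positivity) he1
    nlinarith
  have hsplit : c + s * (e * r) = c * (1 + s * (e * r) / c) := by
    have := h.pos.ne'
    field_simp
  rw [hsplit, Real.log_mul h.pos.ne' (by linarith [neg_abs_le (s * (e * r) / c)]), add_sub_cancel_left]
  exact (abs_log_one_add_le hz').trans (by linarith)

lemma abs_two_log_le (h : SmallAngle σ c s) {e r : ℝ} (he : 0 ≤ e) (he1 : e ≤ 1)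
    (hr : |r| ≤ 5 / 2 * σ) : |2 * Real.log (c + s * (e * r))| ≤ 5 / 2 * σ := by
  have h0 := h.nonneg
  have h6 := h.le_sixth
  have hmul : |s * (e * r)| ≤ 5 / 2 * σ ^ 2 := by
    refine (h.abs_mul_le _).trans ?_
    have := abs_mul_le_of_le_one he he1 hr
    calc σ * |e * r| ≤ σ * (5 / 2 * σ) := by gcongr
      _ = _ := by ring
  have hs : s ^ 2 ≤ σ ^ 2 := by
    rw [← sq_abs]; exact pow_le_pow_left₀ (abs_nonneg _) h.abs_le 2
  have hc : 1 - σ ^ 2 ≤ c := by nlinarith [h.cos_le, h.pos, h.sq_add_sq]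
  have hz : |c + s * (e * r) - 1| ≤ 7 / 2 * σ ^ 2 := by
    have h1 := _root_.abs_le.1 hmul
    rw [_root_.abs_le]
    constructor
    · linarith [h1.1]
    · nlinarith [h1.2, h.cos_le]
  have h2 := abs_log_one_add_le (z := c + s * (e * r) - 1) (hz.trans (by nlinarith))
  rw [add_sub_cancel] at h2
  rw [abs_mul, abs_two]
  nlinarith

/-- Transport of the axis along a segment and the corner after it. -/
lemma transport (h : SmallAngle σ c s) {T x e r : ℝ} (hT : 0 ≤ T) (hx : |x| ≤ 5 / 2 * σ)
    (he : 0 ≤ e) (he1 : e ≤ 1) (hr : |r| ≤ 5 / 2 * σ)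
    (hr' : |rotateSlope c s (e * r)| ≤ 5 / 2 * σ) :
    proj (diagMatrix T) * proj (rotation c s h.sq_add_sq) *
        proj (axisFrame (rotateSlope c s (Real.exp (-T) * x)) (e * r)) =
      proj (axisFrame x (Real.exp (-T) * rotateSlope c s (e * r))) *
        proj (diagMatrix (T + 2 * Real.log (c + s * (e * r)))) := by
  have h0 := h.nonneg
  have h6 := h.le_sixth
  have hE0 := (Real.exp_pos (-T)).le
  have hE1 : Real.exp (-T) ≤ 1 := Real.exp_le_one_iff.2 (by linarith)
  rw [← map_mul, ← map_mul, ← map_mul]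
  congr 1
  refine diag_mul_rotation_mul_axisFrame h.sq_add_sq ?_ ?_ ?_
  · exact h.den_pos ((abs_mul_le_of_le_one he he1 hr).trans (by linarith))
  · exact (h.den_pos ((abs_mul_le_of_le_one hE0 hE1 hx).trans (by linarith))).ne'
  · have h1 := abs_mul_le_of_le_one hE0 hE1 hr'
    have h2 : |x * (Real.exp (-T) * rotateSlope c s (e * r))| ≤ 25 / 144 := by
      rw [abs_mul]
      calc _ ≤ (5 / 2 * σ) * (5 / 2 * σ) := mul_le_mul hx h1 (abs_nonneg _) (by positivity)
        _ ≤ _ := by nlinarith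
    linarith [le_abs_self (x * (Real.exp (-T) * rotateSlope c s (e * r)))]

end SmallAngle

/-- The axis of a closed broken geodesic with two long segments. -/
lemma exists_axis {σ c₁ s₁ c₂ s₂ : ℝ} (h₁ : SmallAngle σ c₁ s₁) (h₂ : SmallAngle σ c₂ s₂)
    {T₁ T₂ T₃ T₄ : ℝ} (hT₁ : 0 < T₁) (hT₂ : 0 < T₂) (hT₃ : 0 < T₃) (hT₄ : 0 < T₄)
    (hl₂ : Real.exp (-T₂) ≤ σ ^ 2) (hl₄ : Real.exp (-T₄) ≤ σ ^ 2) :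
    ∃ x₁ x₂ x₃ x₄ r₁ r₂ r₃ r₄ τ₁ τ₂ τ₃ τ₄ : ℝ,
      (|x₁| ≤ 5 / 2 * σ ∧ |x₂| ≤ 5 / 2 * σ ∧ |x₃| ≤ 5 / 2 * σ ∧ |x₄| ≤ 5 / 2 * σ) ∧
      (|r₁| ≤ 5 / 2 * σ ∧ |r₂| ≤ 5 / 2 * σ ∧ |r₃| ≤ 5 / 2 * σ ∧ |r₄| ≤ 5 / 2 * σ) ∧
      (|τ₁ - T₁| ≤ 5 / 2 * σ ∧ |τ₂ - T₂| ≤ 5 / 2 * σ ∧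
        |τ₃ - T₃| ≤ 5 / 2 * σ ∧ |τ₄ - T₄| ≤ 5 / 2 * σ) ∧
      (proj (diagMatrix T₁) * proj (rotation c₁ s₁ h₁.sq_add_sq) *
          proj (axisFrame x₂ (Real.exp (-T₂) * r₂)) =
        proj (axisFrame x₁ (Real.exp (-T₁) * r₁)) * proj (diagMatrix τ₁)) ∧
      (proj (diagMatrix T₂) * proj (rotation c₁ s₁ h₁.sq_add_sq) *
          proj (axisFrame x₃ (Real.exp (-T₃) * r₃)) =
        proj (axisFrame x₂ (Real.exp (-T₂) * r₂)) * proj (diagMatrix τ₂)) ∧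
      (proj (diagMatrix T₃) * proj (rotation c₂ s₂ h₂.sq_add_sq) *
          proj (axisFrame x₄ (Real.exp (-T₄) * r₄)) =
        proj (axisFrame x₃ (Real.exp (-T₃) * r₃)) * proj (diagMatrix τ₃)) ∧
      (proj (diagMatrix T₄) * proj (rotation c₂ s₂ h₂.sq_add_sq) *
          proj (axisFrame x₁ (Real.exp (-T₁) * r₁)) =
        proj (axisFrame x₄ (Real.exp (-T₄) * r₄)) * proj (diagMatrix τ₄)) ∧
      |(τ₁ + τ₂ + τ₃ + τ₄ - (T₁ + T₂ + T₃ + T₄)) / 2 - Real.log (c₁ ^ 2 * c₂ ^ 2)| ≤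
        6 * σ ^ 2 * (Real.exp (-T₁) + Real.exp (-T₂) + Real.exp (-T₃) + Real.exp (-T₄)) := by
  have hexp : ∀ {T : ℝ}, 0 < T → Real.exp (-T) ≤ 1 := fun hT =>
    Real.exp_le_one_iff.2 (by linarith)
  have hpos : ∀ T : ℝ, 0 ≤ Real.exp (-T) := fun T => (Real.exp_pos _).le
  obtain ⟨r₁, r₂, r₃, r₄, e₁, e₂, e₃, e₄, b₁, b₂, b₃, b₄⟩ := exists_slopes h₁ h₂ (hpos T₁)
    (hexp hT₁) (hpos T₂) hl₂ (hpos T₃) (hexp hT₃) (hpos T₄) hl₄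
  -- Past end points are carried forwards, future ones backwards, so the cyclic order of segments
  -- and corners is reversed.
  obtain ⟨x₁, x₄, x₃, x₂, f₁, f₄, f₃, f₂, a₁, a₄, a₃, a₂⟩ := exists_slopes h₂ h₁ (hpos T₁)
    (hexp hT₁) (hpos T₄) hl₄ (hpos T₃) (hexp hT₃) (hpos T₂) hl₂
  have t₁ := h₁.transport hT₁.le a₁ (hpos T₂) (hexp hT₂) b₂ (by rwa [← e₁])
  have t₂ := h₁.transport hT₂.le a₂ (hpos T₃) (hexp hT₃) b₃ (by rwa [← e₂])
  have t₃ := h₂.transport hT₃.le a₃ (hpos T₄) (hexp hT₄) b₄ (by rwa [← e₃])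
  have t₄ := h₂.transport hT₄.le a₄ (hpos T₁) (hexp hT₁) b₁ (by rwa [← e₄])
  rw [← e₁, ← f₂] at t₁
  rw [← e₂, ← f₃] at t₂
  rw [← e₃, ← f₄] at t₃
  rw [← e₄, ← f₁] at t₄
  refine ⟨x₁, x₂, x₃, x₄, r₁, r₂, r₃, r₄, _, _, _, _, ⟨a₁, a₂, a₃, a₄⟩, ⟨b₁, b₂, b₃, b₄⟩,
    ⟨?_, ?_, ?_, ?_⟩, t₁, t₂, t₃, t₄, ?_⟩
  · rw [add_sub_cancel_left]; exact h₁.abs_two_log_le (hpos _) (hexp hT₂) b₂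
  · rw [add_sub_cancel_left]; exact h₁.abs_two_log_le (hpos _) (hexp hT₃) b₃
  · rw [add_sub_cancel_left]; exact h₂.abs_two_log_le (hpos _) (hexp hT₄) b₄
  · rw [add_sub_cancel_left]; exact h₂.abs_two_log_le (hpos _) (hexp hT₁) b₁
  · have l₁ := abs_le.1 (h₁.abs_log_sub_le (hpos _) (hexp hT₂) b₂)
    have l₂ := abs_le.1 (h₁.abs_log_sub_le (hpos _) (hexp hT₃) b₃)
    have l₃ := abs_le.1 (h₂.abs_log_sub_le (hpos _) (hexp hT₄) b₄)
    have l₄ := abs_le.1 (h₂.abs_log_sub_le (hpos _) (hexp hT₁) b₁)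
    have hlog : Real.log (c₁ ^ 2 * c₂ ^ 2) = 2 * Real.log c₁ + 2 * Real.log c₂ := by
      rw [Real.log_mul (pow_ne_zero 2 h₁.pos.ne') (pow_ne_zero 2 h₂.pos.ne'), Real.log_pow,
        Real.log_pow]
      push_cast; ring
    rw [hlog, abs_le]
    constructor
    · linarith [l₁.1, l₂.1, l₃.1, l₄.1]
    · linarith [l₁.2, l₂.2, l₃.2, l₄.2]

lemma exists_partner {Γ : Subgroup G} {σ c₁ s₁ c₂ s₂ : ℝ} (hσ : 0 < σ)
    (h₁ : SmallAngle σ c₁ s₁) (h₂ : SmallAngle σ c₂ s₂) {g g₁ g₂ g₃ g₄ : G}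
    {T₁ T₂ T₃ T₄ : ℝ} (hT₁ : 0 < T₁) (hT₂ : 0 < T₂) (hT₃ : 0 < T₃) (hT₄ : 0 < T₄)
    (hl₂ : Real.exp (-T₂) ≤ σ ^ 2) (hl₄ : Real.exp (-T₄) ≤ σ ^ 2)
    (hg₁ : g₁ = g * proj (diagMatrix T₁)) (hg₂ : g₂ = g₁ * proj (diagMatrix T₂))
    (hg₃ : g₃ = g₂ * proj (diagMatrix T₃)) (hg₄ : g₄ = g₃ * proj (diagMatrix T₄))
    (H₀ : pt Γ g₄ = pt Γ g)
    (H₁ : ∀ k, pt Γ (g₁ * proj (rotation c₁ s₁ h₁.sq_add_sq) * k) =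
      pt Γ (g₂ * proj reversalMatrix * k))
    (H₂ : ∀ k, pt Γ (g₃ * proj (rotation c₂ s₂ h₂.sq_add_sq) * k) =
      pt Γ (g₄ * proj reversalMatrix * k)) :
    ∃ (c' : Set (X Γ)) (T' : ℝ),
      DiffersInBothEncounters Γ (36 * σ) (pt Γ g) T₁ T₂ T₃ T₄ c' T' ∧
      |(T' - (T₁ + T₂ + T₃ + T₄)) / 2 - Real.log (c₁ ^ 2 * c₂ ^ 2)| ≤
        6 * σ ^ 2 * (Real.exp (-T₁) + Real.exp (-T₂) + Real.exp (-T₃) + Real.exp (-T₄)) := by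
  obtain ⟨x₁, x₂, x₃, x₄, r₁, r₂, r₃, r₄, τ₁, τ₂, τ₃, τ₄, ⟨a₁, a₂, a₃, a₄⟩, ⟨b₁, b₂, b₃, b₄⟩,
    ⟨d₁, d₂, d₃, d₄⟩, t₁, t₂, t₃, t₄, hper⟩ := exists_axis h₁ h₂ hT₁ hT₂ hT₃ hT₄ hl₂ hl₄
  have h6 := h₁.le_sixth
  -- Indeed `e^{-T} ≤ σ² ≤ 1/36 < e^{-1}`; the loops have room for the shifts of order `σ` made
  -- below.
  have hlong : ∀ T : ℝ, Real.exp (-T) ≤ σ ^ 2 → 1 < T := by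
    intro T hT
    by_contra! hcon
    have e1 : Real.exp (-1) ≤ Real.exp (-T) := Real.exp_le_exp.2 (by linarith)
    have e2 : 1 / 3 ≤ Real.exp (-1) := by
      rw [Real.exp_neg, ← one_div]
      exact one_div_le_one_div_of_le (Real.exp_pos _) (by linarith [Real.exp_one_lt_d9])
    nlinarith
  have hT₂' := hlong T₂ hl₂
  have hT₄' := hlong T₄ hl₄
  have c1 := abs_le.1 d₁
  have c2 := abs_le.1 d₂
  have c3 := abs_le.1 d₃
  have c4 := abs_le.1 d₄
  have hcomm : ∀ c s h, proj (rotation c s h) * proj reversalMatrix =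
      proj reversalMatrix * proj (rotation c s h) := fun c s h => by
    rw [← map_mul, rotation_mul_reversal, map_mul]
  have k₁ := flow_to_loop hg₁ H₁ t₁
  have k₂ := flow_through_loop hg₂ (hcomm _ _ _) H₁ t₂
  have k₃ := flow_to_loop hg₃ H₂ t₃
  have k₄ := flow_through_loop hg₄ (hcomm _ _ _) H₂ t₄
  rw [pt_mul_right H₀] at k₄
  set y := pt Γ (g * proj (axisFrame x₁ (Real.exp (-T₁) * r₁))) with hy
  -- A short stretch may have axis time `τ₁` or `τ₃` that is not positive. Each stretch is therefore
  -- lengthened by `δ` at either end at the expense of the loops: `τ₁ + 2 δ ≥ T₁ > 0`, because `2 δ`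
  -- is the bound for `|τ₁ - T₁|`.
  set δ := 5 / 4 * σ with hδ
  have hδabs : |(-δ)| ≤ 4 * σ := by rw [abs_neg, abs_of_pos (by positivity)]; linarith
  have m₁ : ∀ r, flow Γ (τ₁ + r) y = _ := fun r => (flow_add Γ _ _ _).trans (by rw [k₁])
  have m₂ : ∀ r, flow Γ (τ₁ + (τ₂ + r)) y = _ := fun r =>
    (m₁ _).trans ((flow_add Γ _ _ _).trans (by rw [k₂]))
  have m₃ : ∀ r, flow Γ (τ₁ + (τ₂ + (τ₃ + r))) y = _ := fun r =>
    (m₂ _).trans ((flow_add Γ _ _ _).trans (by rw [k₃]))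
  have m₄ : ∀ r, flow Γ (τ₁ + (τ₂ + (τ₃ + (τ₄ + r)))) y = _ := fun r =>
    (m₃ _).trans ((flow_add Γ _ _ _).trans (by rw [k₄]))
  refine ⟨orbit Γ (flow Γ (-δ) y), τ₁ + τ₂ + τ₃ + τ₄, ⟨⟨by linarith, flow Γ (-δ) y, ?_, rfl⟩,
    flow Γ (-δ) y, ⟨0, flow_zero _ _⟩, τ₁ + 2 * δ, τ₁ + τ₂, τ₁ + τ₂ + τ₃ + 2 * δ,
    by linarith, by linarith, by linarith, by linarith, ?_, ?_, ?_, ?_, ?_, ?_, ?_, ?_⟩, hper⟩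
  · rw [← flow_add, show -δ + (τ₁ + τ₂ + τ₃ + τ₄) = τ₁ + (τ₂ + (τ₃ + (τ₄ + -δ))) by ring, m₄]
  · rw [abs_lt]; constructor <;> linarith
  · rw [abs_lt]; constructor <;> linarith
  · rw [abs_lt]; constructor <;> linarith
  · rw [abs_lt]; constructor <;> linarith
  · intro t ht
    rw [← flow_add, add_comm (-δ)]
    exact distX_flow_axis_lt hσ h6 a₁ b₁ ht hδabs g
  · intro t ht
    rw [flow_pt, ← hg₁, flow_eq_timeReversal hg₂, ← flow_add, flow_timeReversal, ← flow_add,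
      show -δ + -(-(τ₁ + τ₂) + t) = τ₁ + (T₂ - t + (τ₂ - T₂ - δ)) by ring, m₁]
    exact distX_timeReversal_flow_axis_lt hσ h6 a₂ b₂ ⟨by linarith [ht.2], by linarith [ht.1]⟩
      (by rw [abs_le]; constructor <;> linarith) _
  · intro t ht
    rw [flow_pt Γ (T₁ + T₂), proj_diag_add, ← mul_assoc, ← hg₁, ← hg₂, ← flow_add, ← flow_add,
      show -δ + (τ₁ + τ₂ + t) = τ₁ + (τ₂ + (t + -δ)) by ring, m₂]
    exact distX_flow_axis_lt hσ h6 a₃ b₃ ht hδabs _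
  · intro t ht
    rw [flow_pt Γ (T₁ + T₂ + T₃), proj_diag_add, proj_diag_add, ← mul_assoc, ← mul_assoc, ← hg₁,
      ← hg₂, ← hg₃, flow_eq_timeReversal hg₄, ← flow_add, flow_timeReversal, ← flow_add,
      show -δ + -(-(τ₁ + τ₂ + τ₃ + τ₄) + t) = τ₁ + (τ₂ + (τ₃ + (T₄ - t + (τ₄ - T₄ - δ)))) by ring,
      m₃]
    exact distX_timeReversal_flow_axis_lt hσ h6 a₄ b₄ ⟨by linarith [ht.2], by linarith [ht.1]⟩
      (by rw [abs_le]; constructor <;> linarith) _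

lemma DiffersInBothEncounters.isPartner {Γ : Subgroup G} {ε T₁ T₂ T₃ T₄ T' : ℝ} {x : X Γ}
    {c' : Set (X Γ)} (hT₁ : 0 < T₁) (hT₂ : 0 < T₂) (hT₃ : 0 < T₃) (hT₄ : 0 < T₄)
    (hx : flow Γ (T₁ + T₂ + T₃ + T₄) x = x)
    (h : DiffersInBothEncounters Γ ε x T₁ T₂ T₃ T₄ c' T') :
    IsPartner Γ ε (orbit Γ x) (T₁ + T₂ + T₃ + T₄) c' T' := by
  obtain ⟨hper, x', hx', t₁, t₂, t₃, h0, h1, h2, h3, -, -, -, -, e1, e2, e3, e4⟩ := h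
  -- The partner runs through the four pieces in the original order, so the permutation is the
  -- identity.
  refine ⟨⟨by linarith, x, hx, rfl⟩, hper, 4, ![0, T₁, T₁ + T₂, T₁ + T₂ + T₃, T₁ + T₂ + T₃ + T₄],
    ![0, t₁, t₂, t₃, T'], 1, by norm_num, ?_, rfl, rfl, ?_, rfl, rfl, x, ⟨0, flow_zero _ _⟩,
    x', hx', ?_⟩
  · rw [Fin.strictMono_iff_lt_succ]
    intro i
    fin_cases i <;> simp <;> linarith
  · rw [Fin.strictMono_iff_lt_succ]
    intro i
    fin_cases i <;> simp <;> linarith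
  · intro j
    fin_cases j
    · left; simpa using e1
    · right; simpa using e2
    · left
      have : T₁ + T₂ + T₃ - (T₁ + T₂) = T₃ := by ring
      simpa [this] using e3
    · right
      have : T₁ + T₂ + T₃ + T₄ - (T₁ + T₂ + T₃) = T₄ := by ring
      simpa [this] using e4

/-- The partner orbit of an orbit with two self-crossings. -/
lemma HasTwoSelfCrossings.exists_partner {Γ : Subgroup G}
    (hΓ : ∀ γ ∈ Γ, γ ≠ 1 → IsHyperbolic γ) {p : ℝ → TX Γ} {T₁ T₂ T₃ T₄ θ₁ θ₂ φ : ℝ} {x : X Γ}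
    (h : HasTwoSelfCrossings Γ p T₁ T₂ T₃ T₄ θ₁ θ₂) (hx : toTX Γ x = p 0)
    (hφ : φ = max (Real.pi - θ₁) (Real.pi - θ₂)) (hφ3 : φ < 1 / 3) :
    ∃ (c' : Set (X Γ)) (T' : ℝ),
      IsPartner Γ (36 * |Real.sin (φ / 2)|) (orbit Γ x) (T₁ + T₂ + T₃ + T₄) c' T' ∧
      DiffersInBothEncounters Γ (36 * |Real.sin (φ / 2)|) x T₁ T₂ T₃ T₄ c' T' ∧
      |(T' - (T₁ + T₂ + T₃ + T₄)) / 2 - Real.log ((1 - Real.sin ((Real.pi - θ₁) / 2) ^ 2) *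
          (1 - Real.sin ((Real.pi - θ₂) / 2) ^ 2))| <
        Real.sin (φ / 2) ^ 2 * (21 * Real.exp (-T₁) + 31 * Real.exp (-T₂) +
          13 * Real.exp (-T₃) + 19 * Real.exp (-T₄)) := by
  obtain ⟨horb, hper, hT₁, hT₃, hcr₁, hcr₂⟩ := h
  obtain ⟨A, rfl, hp⟩ := horb.exists_lift hx
  have hper0 := hper 0
  rw [zero_add, hp, hp] at hper0
  have hflow := flow_eq_self_of_periodic hper0
  obtain ⟨c₁, s₁, hcs₁, hc₁, hs₁, γ₁, hγ₁, hrel₁⟩ := hcr₁.exists_rotation hp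
  obtain ⟨c₂, s₂, hcs₂, hc₂, hs₂, γ₂, hγ₂, hrel₂⟩ := hcr₂.exists_rotation hp
  have hl₂ := exp_neg_lt_of_isHyperbolic hΓ hcs₁ hcr₁.1 hγ₁ hrel₁
  have hl₄ := exp_neg_lt_of_isHyperbolic hΓ hcs₂ hcr₂.1 hγ₂ hrel₂
  obtain ⟨hT₂, hθ₁, hθ₁', -⟩ := hcr₁
  obtain ⟨hT₄, hθ₂, hθ₂', -⟩ := hcr₂
  have hφ1 : Real.pi - θ₁ ≤ φ := hφ ▸ le_max_left _ _
  have hφ2 : Real.pi - θ₂ ≤ φ := hφ ▸ le_max_right _ _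
  set σ := Real.sin (φ / 2) with hσ
  have hpi := Real.pi_gt_three
  have hσ0 : 0 < σ := Real.sin_pos_of_pos_of_lt_pi (by linarith) (by linarith)
  have hσ6 : σ ≤ 1 / 6 := (Real.sin_lt (by linarith)).le.trans (by linarith)
  have hsmall : ∀ {θ s : ℝ}, θ < Real.pi → Real.pi - θ ≤ φ →
      s ^ 2 = Real.sin ((Real.pi - θ) / 2) ^ 2 → |s| ≤ σ := by
    intro θ s hθ hle hs
    have h1 : 0 ≤ Real.sin ((Real.pi - θ) / 2) :=
      Real.sin_nonneg_of_nonneg_of_le_pi (by linarith) (by linarith)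
    rw [(sq_eq_sq_iff_abs_eq_abs _ _).1 hs, abs_of_nonneg h1]
    exact Real.sin_le_sin_of_le_of_le_pi_div_two (by linarith) (by linarith) (by linarith)
  have h₁ : SmallAngle σ c₁ s₁ := ⟨hcs₁, hc₁, hsmall hθ₁' hφ1 hs₁, hσ6⟩
  have h₂ : SmallAngle σ c₂ s₂ := ⟨hcs₂, hc₂, hsmall hθ₂' hφ2 hs₂, hσ6⟩
  have hsq : ∀ {c s : ℝ}, SmallAngle σ c s → s ^ 2 ≤ σ ^ 2 := fun h => by
    rw [← sq_abs]; exact pow_le_pow_left₀ (abs_nonneg _) h.abs_le 2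
  have hd : A * diagMatrix (T₁ + T₂ + T₃) =
      A * diagMatrix T₁ * diagMatrix T₂ * diagMatrix T₃ := by
    simp only [diagMatrix_add, mul_assoc]
  rw [hd] at hrel₂
  obtain ⟨c', T', hdiff, hest⟩ := HadamardGutzwiller.exists_partner (Γ := Γ) hσ0 h₁ h₂ hT₁ hT₂ hT₃
    hT₄ (hl₂.le.trans (hsq h₁)) (hl₄.le.trans (hsq h₂)) (g := proj A)
    (g₁ := proj (A * diagMatrix T₁)) (g₂ := proj (A * diagMatrix T₁ * diagMatrix T₂))
    (g₃ := proj (A * diagMatrix T₁ * diagMatrix T₂ * diagMatrix T₃))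
    (g₄ := proj (A * diagMatrix T₁ * diagMatrix T₂ * diagMatrix T₃ * diagMatrix T₄))
    (map_mul _ _ _) (map_mul _ _ _) (map_mul _ _ _) (map_mul _ _ _)
    (by
      rw [flow_pt, ← map_mul, diagMatrix_add, ← mul_assoc, hd] at hflow
      exact hflow)
    (pt_crossing hγ₁ hrel₁) (pt_crossing hγ₂ hrel₂)
  rw [abs_of_pos hσ0]
  refine ⟨c', T', hdiff.isPartner hT₁ hT₂ hT₃ hT₄ hflow, hdiff, ?_⟩
  rw [← hs₁, ← hs₂, ← show c₁ ^ 2 = 1 - s₁ ^ 2 by linarith, ← show c₂ ^ 2 = 1 - s₂ ^ 2 by linarith]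
  refine hest.trans_lt ?_
  have hσ2 : 0 < σ ^ 2 := by positivity
  -- The coefficient 6 is smaller than each of 21, 31, 13 and 19.
  nlinarith [mul_pos hσ2 (Real.exp_pos (-T₁)), mul_pos hσ2 (Real.exp_pos (-T₂)),
    mul_pos hσ2 (Real.exp_pos (-T₃)), mul_pos hσ2 (Real.exp_pos (-T₄))]

/-! ### Elements of `PSL(2,ℝ)` close to the identity -/

lemma Close.inv {δ : ℝ} {A : SL(2, ℝ)} (h : Close δ A) : Close δ A⁻¹ := by
  obtain ⟨h1, h2, h3, h4⟩ := inv_apply_entries A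
  have e := h
  intro i j
  fin_cases i <;> fin_cases j
  · simpa [h1] using e 1 1
  · simpa [h2] using e 0 1
  · simpa [h3] using e 1 0
  · simpa [h4] using e 0 0

lemma Close.nonneg {δ : ℝ} {A : SL(2, ℝ)} (h : Close δ A) : 0 ≤ δ := (abs_nonneg _).trans (h 0 0)

/-- Expand `AB - 1 = (A - 1) + (B - 1) + (A - 1)(B - 1)`; as `δ' ≤ 1 / 2`, the last term costs at
most another `δ`. -/
lemma Close.mul {δ δ' : ℝ} {A B : SL(2, ℝ)} (hA : Close δ A) (hB : Close δ' B) (hδ' : δ' ≤ 1 / 2) :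
    Close (2 * δ + δ') (A * B) := by
  have hδ := hA.nonneg
  have key : ∀ i j, (A * B) i j - (1 : SL(2, ℝ)) i j =
      (A i j - (1 : SL(2, ℝ)) i j) + (B i j - (1 : SL(2, ℝ)) i j) +
      ((A i 0 - (1 : SL(2, ℝ)) i 0) * (B 0 j - (1 : SL(2, ℝ)) 0 j) +
        (A i 1 - (1 : SL(2, ℝ)) i 1) * (B 1 j - (1 : SL(2, ℝ)) 1 j)) := by
    intro i j
    rw [mul_apply_two]
    fin_cases i <;> fin_cases j <;> simp <;> ring
  have hprod : ∀ i k j, |(A i k - (1 : SL(2, ℝ)) i k) * (B k j - (1 : SL(2, ℝ)) k j)| ≤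
      δ * (1 / 2) := fun i k j => by
    rw [abs_mul]
    exact mul_le_mul (hA i k) ((hB k j).trans hδ') (abs_nonneg _) hδ
  intro i j
  rw [key]
  refine (abs_add_le _ _).trans ?_
  have h1 := (abs_add_le (A i j - (1 : SL(2, ℝ)) i j) (B i j - (1 : SL(2, ℝ)) i j)).trans
    (add_le_add (hA i j) (hB i j))
  have h2 := (abs_add_le _ _).trans (add_le_add (hprod i 0 j) (hprod i 1 j))
  linarith

/-- An element of `PSL(2,ℝ)` with a representative close to the identity. -/
def GClose (δ : ℝ) (g : G) : Prop := ∃ N : SL(2, ℝ), g = proj N ∧ Close δ N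

lemma GClose.mono {δ δ' : ℝ} {g : G} (h : GClose δ g) (hδ : δ ≤ δ') : GClose δ' g := by
  obtain ⟨N, rfl, hN⟩ := h
  exact ⟨N, rfl, fun i j => (hN i j).trans hδ⟩

lemma GClose.inv {δ : ℝ} {g : G} (h : GClose δ g) : GClose δ g⁻¹ := by
  obtain ⟨N, rfl, hN⟩ := h
  exact ⟨N⁻¹, by rw [map_inv], hN.inv⟩

lemma GClose.mul {δ δ' : ℝ} {g h : G} (hg : GClose δ g) (hh : GClose δ' h) (hδ' : δ' ≤ 1 / 2) :
    GClose (2 * δ + δ') (g * h) := by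
  obtain ⟨N, rfl, hN⟩ := hg
  obtain ⟨N', rfl, hN'⟩ := hh
  exact ⟨N * N', by rw [map_mul], hN.mul hN' hδ'⟩

lemma gClose_diagMatrix {t δ : ℝ} (h : |t| ≤ δ) (hδ : δ ≤ 1) : GClose δ (proj (diagMatrix t)) := by
  refine ⟨_, rfl, ?_⟩
  have h0 : 0 ≤ δ := (abs_nonneg _).trans h
  have ht : |t / 2| = |t| / 2 := by rw [abs_div, abs_two]
  have h1 := Real.abs_exp_sub_one_le (x := t / 2) (by rw [ht]; linarith)
  have h2 := Real.abs_exp_sub_one_le (x := -(t / 2)) (by rw [abs_neg, ht]; linarith)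
  rw [abs_neg] at h2
  intro i j
  fin_cases i <;> fin_cases j
  · simp; linarith
  · simpa using h0
  · simpa using h0
  · simp; linarith

lemma GClose.conj_reversal {δ : ℝ} {g : G} (h : GClose δ g) :
    GClose δ (proj reversalMatrix * g * proj reversalMatrix) := by
  obtain ⟨N, rfl, hN⟩ := h
  -- The sign compensates for `d_π² = -1` in SL(2,ℝ), so that the representative is near `1` and not
  -- near `-1`.
  refine ⟨-(reversalMatrix * N * reversalMatrix), by rw [proj_neg, map_mul, map_mul], ?_⟩
  have e := hN
  intro i j
  fin_cases i <;> fin_cases j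
  · simpa [Matrix.mul_apply, Fin.sum_univ_two] using e 1 1
  · simpa [Matrix.mul_apply, Fin.sum_univ_two] using e 1 0
  · simpa [Matrix.mul_apply, Fin.sum_univ_two] using e 0 1
  · simpa [Matrix.mul_apply, Fin.sum_univ_two] using e 0 0

/-- Two points of `X` with representatives that differ by an element close to the identity. -/
def Near (Γ : Subgroup G) (δ : ℝ) (x y : X Γ) : Prop :=
  ∃ g h : G, pt Γ g = x ∧ pt Γ h = y ∧ GClose δ (g⁻¹ * h)

section Near

variable {Γ : Subgroup G} {δ δ' : ℝ} {x y z : X Γ}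

lemma near_of_distX_lt {ε : ℝ} (hε : ε ≤ 1 / 4) (h : distX Γ x y < ε) : Near Γ (2 * ε) x y := by
  obtain ⟨g, hg⟩ := pt_surjective Γ x
  obtain ⟨k, hk⟩ := pt_surjective Γ y
  obtain ⟨_, ⟨g₁, g₂, h₁, h₂, rfl⟩, hlt⟩ := exists_lt_of_csInf_lt
    (s := {r : ℝ | ∃ g₁ g₂ : G, pt Γ g₁ = x ∧ pt Γ g₂ = y ∧ r = distG g₁ g₂})
    ⟨_, g, k, hg, hk, rfl⟩ h
  obtain ⟨N, hN, hc⟩ := exists_close_of_distG_lt hε hlt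
  exact ⟨g₁, g₂, h₁, h₂, N, hN, hc⟩

/-- Allows both representatives to be prescribed, at the price of a deck transformation. -/
lemma Near.exists_mem {g h : G} (hn : Near Γ δ (pt Γ g) (pt Γ h)) :
    ∃ γ ∈ Γ, GClose δ (g⁻¹ * (γ * h)) := by
  obtain ⟨g', h', hg, hh, hc⟩ := hn
  obtain ⟨γ₁, hγ₁, rfl⟩ := pt_eq_iff.1 hg
  obtain ⟨γ₂, hγ₂, rfl⟩ := pt_eq_iff.1 hh
  refine ⟨γ₁ * γ₂⁻¹, Γ.mul_mem hγ₁ (Γ.inv_mem hγ₂), ?_⟩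
  convert hc using 1
  group

lemma Near.symm (h : Near Γ δ x y) : Near Γ δ y x := by
  obtain ⟨g, k, hg, hk, hc⟩ := h
  refine ⟨k, g, hk, hg, ?_⟩
  have := hc.inv
  rwa [mul_inv_rev, inv_inv] at this

lemma Near.mono (h : Near Γ δ x y) (hδ : δ ≤ δ') : Near Γ δ' x y := by
  obtain ⟨g, k, hg, hk, hc⟩ := h
  exact ⟨g, k, hg, hk, hc.mono hδ⟩

lemma Near.trans (h : Near Γ δ x y) (h' : Near Γ δ' y z) (hδ' : δ' ≤ 1 / 2) :
    Near Γ (2 * δ + δ') x z := by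
  obtain ⟨g, k, rfl, rfl, hc⟩ := h
  obtain ⟨m, rfl⟩ := pt_surjective Γ z
  obtain ⟨γ, hγ, hc'⟩ := h'.exists_mem
  refine ⟨g, γ * m, rfl, (pt_eq_iff.2 ⟨γ, hγ, rfl⟩).symm, ?_⟩
  convert hc.mul hc' hδ' using 1
  group

lemma Near.timeReversal (h : Near Γ δ x y) :
    Near Γ δ (timeReversal Γ x) (timeReversal Γ y) := by
  obtain ⟨g, k, rfl, rfl, hc⟩ := h
  refine ⟨_, _, rfl, rfl, ?_⟩
  convert hc.conj_reversal using 1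
  rw [mul_inv_rev, inv_eq_of_mul_eq_one_left proj_reversal_mul_self]
  simp only [mul_assoc]

lemma timeReversal_timeReversal (x : X Γ) : timeReversal Γ (timeReversal Γ x) = x := by
  obtain ⟨g, rfl⟩ := pt_surjective Γ x
  rw [timeReversal_pt, timeReversal_pt, mul_assoc, proj_reversal_mul_self, mul_one]

lemma near_flow {s t : ℝ} (h : |s - t| ≤ δ) (hδ : δ ≤ 1) (x : X Γ) :
    Near Γ δ (flow Γ s x) (flow Γ t x) := by
  obtain ⟨g, rfl⟩ := pt_surjective Γ x
  refine ⟨_, _, rfl, rfl, ?_⟩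
  rw [mul_inv_rev, mul_assoc, inv_mul_cancel_left, ← map_inv, ← diagMatrix_neg, ← proj_diag_add]
  exact gClose_diagMatrix (by rwa [neg_add_eq_sub, abs_sub_comm]) hδ

end Near

/-! ### The injectivity radius of a compact surface -/

lemma continuous_proj : Continuous proj := continuous_quot_mk

lemma exists_close_imp_eq_one (Γ : Subgroup G) [DiscreteTopology Γ] :
    ∃ η > 0, ∀ N : SL(2, ℝ), Close η N → proj N ∈ Γ → proj N = 1 := by
  obtain ⟨U, hU, hU1⟩ := isOpen_induced_iff.1 (isOpen_discrete ({1} : Set Γ))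
  obtain ⟨W, hW, hWU⟩ := isOpen_induced_iff.1 (hU.preimage continuous_proj)
  have h1U : (1 : G) ∈ U := by
    have : (1 : Γ) ∈ (Subtype.val ⁻¹' U : Set Γ) := by rw [hU1]; rfl
    exact this
  have h1W : ((1 : SL(2, ℝ)) : Matrix (Fin 2) (Fin 2) ℝ) ∈ W := by
    have : (1 : SL(2, ℝ)) ∈ (Subtype.val ⁻¹' W : Set SL(2, ℝ)) := by
      rw [hWU]; simpa using h1U
    exact this
  have hW' : IsOpen (X := Fin 2 → Fin 2 → ℝ) W := hW
  obtain ⟨η, hη, hball⟩ := Metric.isOpen_iff.1 hW' _ h1W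
  refine ⟨η / 2, by linarith, fun N hN hNΓ => ?_⟩
  have hNW : (N : Matrix (Fin 2) (Fin 2) ℝ) ∈ W := by
    refine hball ?_
    refine (dist_pi_lt_iff hη).2 fun i => (dist_pi_lt_iff hη).2 fun j => ?_
    exact (hN i j).trans_lt (by linarith)
  have hNU : proj N ∈ U := by
    have : N ∈ (proj ⁻¹' U) := by rw [← hWU]; exact hNW
    exact this
  have : (⟨proj N, hNΓ⟩ : Γ) ∈ ({1} : Set Γ) := by rw [← hU1]; exact hNU
  exact congrArg Subtype.val this

/-- Turns a bound for the displacement of `i` into one for the matrix entries. -/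
lemma cosh_dist_smul_I (K : SL(2, ℝ)) :
    2 * Real.cosh (dist (K • UpperHalfPlane.I) UpperHalfPlane.I) =
      K 0 0 ^ 2 + K 0 1 ^ 2 + K 1 0 ^ 2 + K 1 1 ^ 2 := by
  have hd := sl2_det K
  have hm : 0 < K 1 0 ^ 2 + K 1 1 ^ 2 := by
    rcases eq_or_ne (K 1 0) 0 with h | h
    · have : K 1 1 ≠ 0 := fun h' => by rw [h, h'] at hd; simp at hd
      positivity
    · positivity
  have hcoe : ((K • UpperHalfPlane.I : ℍ) : ℂ) =
      ⟨(K 0 0 * K 1 0 + K 0 1 * K 1 1) / (K 1 0 ^ 2 + K 1 1 ^ 2),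
        1 / (K 1 0 ^ 2 + K 1 1 ^ 2)⟩ := by
    rw [coe_smul_eq, div_eq_iff (den_ne_zero _ _)]
    apply Complex.ext
    · simp [den]
      field_simp
      linear_combination (-K 1 0) * hd
    · simp [den]
      field_simp
      linear_combination (K 1 1) * hd
  have hre : (K • UpperHalfPlane.I).re =
      (K 0 0 * K 1 0 + K 0 1 * K 1 1) / (K 1 0 ^ 2 + K 1 1 ^ 2) := congrArg Complex.re hcoe
  have him : (K • UpperHalfPlane.I).im = 1 / (K 1 0 ^ 2 + K 1 1 ^ 2) := congrArg Complex.im hcoe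
  rw [cosh_dist', hre, him]
  simp
  field_simp
  linear_combination (-(K 0 0 * K 1 1 - K 0 1 * K 1 0) - 1) * hd

/-- On a compact surface all frames have bounded representatives. -/
lemma exists_bounded_representative (Γ : Subgroup G) [CompactSpace (Surface Γ)] :
    ∃ R : ℝ, 1 ≤ R ∧ ∀ g : G, ∃ γ ∈ Γ, ∃ K : SL(2, ℝ), γ * g = proj K ∧ ∀ i j, |K i j| ≤ R := by
  let q : ℍ → Surface Γ := Quotient.mk _
  have hq : IsOpenMap q := isOpenMap_quotient_mk'_mul
  -- The images of the balls around `i` form an increasing open cover of the compact surface, so one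
  -- ball meets every orbit.
  obtain ⟨n, hn⟩ := (isCompact_univ (X := Surface Γ)).elim_directed_cover
    (fun n : ℕ => q '' Metric.ball UpperHalfPlane.I n) (fun n => hq _ Metric.isOpen_ball)
    (by
      intro y _
      obtain ⟨z, rfl⟩ := Quotient.exists_rep y
      obtain ⟨n, hn⟩ := exists_nat_gt (dist z UpperHalfPlane.I)
      exact Set.mem_iUnion.2 ⟨n, z, hn, rfl⟩)
    (directed_of_isDirected_le fun m n hmn => Set.image_mono
      (Metric.ball_subset_ball (by exact_mod_cast hmn)))
  have hcosh := Real.one_le_cosh (n : ℝ)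
  refine ⟨2 * Real.cosh n, by linarith, fun g => ?_⟩
  obtain ⟨A, rfl⟩ := proj_surjective g
  obtain ⟨w, hw, hwz⟩ := hn (Set.mem_univ (q (A • UpperHalfPlane.I)))
  obtain ⟨C, hC⟩ := MulAction.orbitRel_apply.1 (Quotient.exact hwz)
  refine ⟨proj C, C.2, C * A, by rw [map_mul], ?_⟩
  have hCw : (C * A : SL(2, ℝ)) • UpperHalfPlane.I = w := by rw [mul_smul]; exact hC
  have hle : 2 * Real.cosh (dist ((C * A : SL(2, ℝ)) • UpperHalfPlane.I) UpperHalfPlane.I) ≤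
      2 * Real.cosh n := by
    rw [hCw]
    have : dist w UpperHalfPlane.I < n := hw
    have := Real.cosh_le_cosh.2 (show |dist w UpperHalfPlane.I| ≤ |(n : ℝ)| by
      rw [abs_of_nonneg dist_nonneg, abs_of_nonneg (Nat.cast_nonneg n)]; exact this.le)
    linarith
  rw [cosh_dist_smul_I] at hle
  generalize (C * A : SL(2, ℝ)) = K at hle
  have hsq : ∀ a : ℝ, a ^ 2 ≤ 2 * Real.cosh n → |a| ≤ 2 * Real.cosh n := by
    intro a ha
    rw [← sq_abs] at ha
    by_contra! hcon
    nlinarith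
  have := sq_nonneg (K 0 0)
  have := sq_nonneg (K 0 1)
  have := sq_nonneg (K 1 0)
  have := sq_nonneg (K 1 1)
  intro i j
  fin_cases i <;> fin_cases j <;> apply hsq <;> simp <;> linarith

lemma Close.conj {δ R : ℝ} {N K : SL(2, ℝ)} (hN : Close δ N) (hK : ∀ i j, |K i j| ≤ R) :
    Close (4 * R ^ 2 * δ) (K * N * K⁻¹) := by
  have hR : 0 ≤ R := (abs_nonneg _).trans (hK 0 0)
  have hKi : ∀ i j, |(K⁻¹) i j| ≤ R := by
    obtain ⟨h1, h2, h3, h4⟩ := inv_apply_entries K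
    intro i j
    fin_cases i <;> fin_cases j
    · simpa [h1] using hK 1 1
    · simpa [h2] using hK 0 1
    · simpa [h3] using hK 1 0
    · simpa [h4] using hK 0 0
  have hmat : ((K * N * K⁻¹ : SL(2, ℝ)) : Matrix (Fin 2) (Fin 2) ℝ) - (1 : SL(2, ℝ)) =
      (K : Matrix (Fin 2) (Fin 2) ℝ) * ((N : Matrix (Fin 2) (Fin 2) ℝ) - (1 : SL(2, ℝ))) *
        ((K⁻¹ : SL(2, ℝ)) : Matrix (Fin 2) (Fin 2) ℝ) := by
    rw [Matrix.mul_sub, Matrix.sub_mul, ← Matrix.SpecialLinearGroup.coe_mul,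
      ← Matrix.SpecialLinearGroup.coe_mul, ← Matrix.SpecialLinearGroup.coe_mul,
      ← Matrix.SpecialLinearGroup.coe_mul, mul_one, mul_inv_cancel]
  intro i j
  have hent := congrFun (congrFun hmat i) j
  simp only [Matrix.sub_apply, Matrix.mul_apply, Fin.sum_univ_two] at hent
  rw [hent]
  have hterm : ∀ k l, |K i k * (N k l - (1 : SL(2, ℝ)) k l) * (K⁻¹) l j| ≤ R * δ * R := by
    intro k l
    rw [abs_mul, abs_mul]
    exact mul_le_mul (mul_le_mul (hK _ _) (hN _ _) (abs_nonneg _) hR) (hKi _ _) (abs_nonneg _)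
      (mul_nonneg hR hN.nonneg)
  rw [add_mul, add_mul]
  refine (abs_add_le _ _).trans ?_
  have h1 := (abs_add_le _ _).trans (add_le_add (hterm 0 0) (hterm 1 0))
  have h2 := (abs_add_le _ _).trans (add_le_add (hterm 0 1) (hterm 1 1))
  linarith

/-- Discreteness isolates the identity of Γ. Conjugating by a bounded representative `K` of the
frame enlarges deviations at most by the factor `4 R²`, so the isolation is uniform over all frames.
-/
lemma exists_injectivity_radius (Γ : Subgroup G) [DiscreteTopology Γ] [CompactSpace (Surface Γ)] :
    ∃ δ > 0, δ ≤ 1 ∧ ∀ g : G, ∀ γ ∈ Γ, GClose δ (g⁻¹ * γ * g) → γ = 1 := by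
  obtain ⟨η, hη, hηΓ⟩ := exists_close_imp_eq_one Γ
  obtain ⟨R, hR, hRΓ⟩ := exists_bounded_representative Γ
  have hR0 : 0 < 4 * R ^ 2 := by positivity
  refine ⟨min 1 (η / (4 * R ^ 2)), by positivity, min_le_left _ _, ?_⟩
  rintro g γ hγ hc
  obtain ⟨N, hN, hNc⟩ := hc.mono (min_le_right _ _)
  obtain ⟨γ₀, hγ₀, K, hK, hKR⟩ := hRΓ g
  have hc' := hNc.conj hKR
  rw [mul_div_cancel₀ _ hR0.ne'] at hc'
  have hconj : proj (K * N * K⁻¹) = γ₀ * γ * γ₀⁻¹ := by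
    rw [map_mul, map_mul, map_inv, ← hK, ← hN]
    group
  have h1 := hηΓ _ hc' (by
    rw [hconj]; exact Γ.mul_mem (Γ.mul_mem hγ₀ hγ) (Γ.inv_mem hγ₀))
  rw [hconj] at h1
  exact conj_eq_one_iff.1 h1

/-! ### Expansivity -/

lemma orbit_flow (Γ : Subgroup G) (t : ℝ) (x : X Γ) : orbit Γ (flow Γ t x) = orbit Γ x := by
  ext y
  constructor
  · rintro ⟨s, rfl⟩
    exact ⟨t + s, flow_add _ _ _ _⟩
  · rintro ⟨s, rfl⟩
    exact ⟨s - t, by simp only; rw [← flow_add]; congr 1; ring⟩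

/-- Positivity of `W 0 0` excludes the minus sign, and the upper left entries then give `S = T`. The
off-diagonal entries are annihilated by `e^{T/2} - e^{-T/2} ≠ 0`. -/
lemma eq_diagMatrix_of_commute {W : SL(2, ℝ)} {S T δ : ℝ} (hT : 0 < T) (hW : Close δ W)
    (hδ : δ < 1) (h : proj (W * diagMatrix S) = proj (diagMatrix T * W)) :
    S = T ∧ ∃ z, W = diagMatrix z := by
  have h00 : 0 < W 0 0 := by
    have := hW 0 0
    simp at this
    linarith [(abs_le.1 this).1]
  rcases proj_eq_iff.1 h with h | h
  · have e00 := congrArg (fun M : SL(2, ℝ) => M 0 0) h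
    have e01 := congrArg (fun M : SL(2, ℝ) => M 0 1) h
    have e10 := congrArg (fun M : SL(2, ℝ) => M 1 0) h
    simp [mul_apply_two] at e00 e01 e10
    have hST : S = T := by
      have : Real.exp (T / 2) = Real.exp (S / 2) := by
        rw [mul_comm] at e00
        exact mul_left_cancel₀ h00.ne' e00
      linarith [Real.exp_injective this]
    subst hST
    have hlt : Real.exp (-(S / 2)) < Real.exp (S / 2) := Real.exp_lt_exp.2 (by linarith)
    have h01 : W 0 1 = 0 := by
      have : (Real.exp (S / 2) - Real.exp (-(S / 2))) * W 0 1 = 0 := by linarith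
      exact (mul_eq_zero.1 this).resolve_left (by linarith)
    have h10 : W 1 0 = 0 := by
      have : (Real.exp (S / 2) - Real.exp (-(S / 2))) * W 1 0 = 0 := by linarith
      exact (mul_eq_zero.1 this).resolve_left (by linarith)
    refine ⟨rfl, 2 * Real.log (W 0 0), sl2_ext_of_ne_zero h00.ne' ?_ h01 h10⟩
    simp [Real.exp_log h00]
  · exfalso
    have e00 := congrArg (fun M : SL(2, ℝ) => M 0 0) h
    simp [Matrix.mul_apply, Fin.sum_univ_two] at e00
    have p1 := mul_pos (Real.exp_pos (T / 2)) h00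
    have p2 := mul_pos h00 (Real.exp_pos (S / 2))
    linarith

section Expansivity

variable {Γ : Subgroup G} {δ β : ℝ}

/-- Along two orbits that stay close, the deck transformation that matches them is constant. -/
lemma exists_constant_deck (hβ : 0 < β) (hβδ : 15 * β ≤ δ) (hδ : δ ≤ 1)
    (hinj : ∀ g : G, ∀ γ ∈ Γ, GClose δ (g⁻¹ * γ * g) → γ = 1) {g₁ g₂ : G} {m : ℝ} (hm : 0 ≤ m)
    (h : ∀ t ∈ Set.Icc 0 m, Near Γ β (flow Γ t (pt Γ g₁)) (flow Γ t (pt Γ g₂))) :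
    ∃ γ ∈ Γ, ∀ t ∈ Set.Icc 0 m,
      GClose β ((g₁ * proj (diagMatrix t))⁻¹ * (γ * (g₂ * proj (diagMatrix t)))) := by
  have h' : ∀ t : ℝ, ∃ γ : G, t ∈ Set.Icc 0 m → γ ∈ Γ ∧
      GClose β ((g₁ * proj (diagMatrix t))⁻¹ * (γ * (g₂ * proj (diagMatrix t)))) := by
    intro t
    by_cases ht : t ∈ Set.Icc 0 m
    · obtain ⟨γ, hγ, hc⟩ := (h t ht).exists_mem
      exact ⟨γ, fun _ => ⟨hγ, hc⟩⟩
    · exact ⟨1, fun h => absurd h ht⟩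
  choose γ hγ using h'
  have hβ2 : β ≤ 1 / 2 := by linarith
  have hstep : ∀ s ∈ Set.Icc 0 m, ∀ t ∈ Set.Icc 0 m, |s - t| ≤ β → γ t = γ s := by
    intro s hs t ht hst
    obtain ⟨hsΓ, hsc⟩ := hγ s hs
    obtain ⟨htΓ, htc⟩ := hγ t ht
    have d1 : GClose β (proj (diagMatrix (t - s))) :=
      gClose_diagMatrix (by rwa [abs_sub_comm]) (by linarith)
    have d2 : GClose β (proj (diagMatrix (s - t))) := gClose_diagMatrix hst (by linarith)
    -- Four factors, each `β`-close, multiply up to `15 β`; this fixes the ratio of `δ` to `β`.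
    have hc := (((hsc.inv.mul d1 hβ2).mul htc hβ2).mul d2 hβ2).mono
      (by linarith : 2 * (2 * (2 * β + β) + β) + β ≤ δ)
    have hone : (γ s)⁻¹ * γ t = 1 := by
      refine hinj (g₂ * proj (diagMatrix s)) _ (Γ.mul_mem (Γ.inv_mem hsΓ) htΓ) ?_
      convert hc using 1
      have e1 : proj (diagMatrix (t - s)) = (proj (diagMatrix s))⁻¹ * proj (diagMatrix t) := by
        rw [← map_inv, ← diagMatrix_neg, ← proj_diag_add]; congr 2; ring
      have e2 : proj (diagMatrix (s - t)) = (proj (diagMatrix t))⁻¹ * proj (diagMatrix s) := by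
        rw [← map_inv, ← diagMatrix_neg, ← proj_diag_add]; congr 2; ring
      rw [e1, e2]
      group
    exact (inv_mul_eq_one.1 hone).symm
  -- Reach `t` from `0` in steps of length at most `β`.
  have hconst : ∀ n : ℕ, ∀ t ∈ Set.Icc 0 m, t ≤ n * β → γ t = γ 0 := by
    intro n
    induction n with
    | zero =>
      intro t ht htn
      have : t = 0 := le_antisymm (by simpa using htn) ht.1
      rw [this]
    | succ n ih =>
      intro t ht htn
      push_cast at htn
      have hmem : max 0 (t - β) ∈ Set.Icc 0 m :=
        ⟨le_max_left _ _, max_le hm (by linarith [ht.2])⟩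
      rw [← ih _ hmem (max_le (by positivity) (by linarith))]
      refine hstep _ hmem t ht ?_
      rcases max_cases 0 (t - β) with ⟨h1, h2⟩ | ⟨h1, h2⟩ <;> rw [h1, abs_le] <;>
        constructor <;> linarith [ht.1]
  refine ⟨γ 0, (hγ 0 ⟨le_rfl, hm⟩).1, fun t ht => ?_⟩
  obtain ⟨n, hn⟩ := exists_nat_ge (t / β)
  rw [← hconst n t ht ((div_le_iff₀ hβ).1 hn)]
  exact (hγ t ht).2

lemma expansive_of_le (hβ : 0 < β) (hβδ : 15 * β ≤ δ) (hδ : δ ≤ 1)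
    (hinj : ∀ g : G, ∀ γ ∈ Γ, GClose δ (g⁻¹ * γ * g) → γ = 1) {x₁ x₂ : X Γ} {T₁ T₂ : ℝ}
    (hT₁ : 0 < T₁) (h₁ : flow Γ T₁ x₁ = x₁) (h₂ : flow Γ T₂ x₂ = x₂) (hT : |T₁ - T₂| ≤ β)
    (h : ∀ t ∈ Set.Icc 0 T₁, Near Γ β (flow Γ t x₁) (flow Γ t x₂)) :
    T₁ = T₂ ∧ orbit Γ x₁ = orbit Γ x₂ := by
  obtain ⟨g₁, rfl⟩ := pt_surjective Γ x₁
  obtain ⟨g₂, rfl⟩ := pt_surjective Γ x₂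
  obtain ⟨γ, hγ, hc⟩ := exists_constant_deck hβ hβδ hδ hinj hT₁.le h
  have hβ2 : β ≤ 1 / 2 := by linarith
  have hpt : pt Γ g₂ = pt Γ (γ * g₂) := pt_eq_iff.2 ⟨γ, hγ, rfl⟩
  rw [hpt] at h₂ ⊢
  simp only [← mul_assoc γ] at hc
  generalize γ * g₂ = k at h₂ hc ⊢
  obtain ⟨ζ₁, hζ₁, (e₁ : g₁ * proj (diagMatrix T₁) = ζ₁ * g₁)⟩ := pt_eq_iff.1 h₁.symm
  obtain ⟨ζ₂, hζ₂, (e₂ : k * proj (diagMatrix T₂) = ζ₂ * k)⟩ := pt_eq_iff.1 h₂.symm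
  have c0 := hc 0 ⟨le_rfl, hT₁.le⟩
  have cT := hc T₁ ⟨hT₁.le, le_rfl⟩
  simp only [diagMatrix_zero, map_one, mul_one] at c0
  have hkT : k * proj (diagMatrix T₁) = ζ₂ * k * proj (diagMatrix (T₁ - T₂)) := by
    rw [← e₂, mul_assoc, ← proj_diag_add]; congr 3; ring
  rw [e₁, hkT] at cT
  have d : GClose β (proj (diagMatrix (T₁ - T₂))) := gClose_diagMatrix hT (by linarith)
  -- Comparing the closeness at the times `0` and `T₁` shows that the holonomies of the two orbits,
  -- in matched lifts, differ by an element of Γ within the injectivity radius.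
  have hζ : ζ₁⁻¹ * ζ₂ = 1 := by
    refine hinj g₁ _ (Γ.mul_mem (Γ.inv_mem hζ₁) hζ₂) ?_
    have := ((cT.mul d.inv hβ2).mul c0.inv hβ2).mono
      (by linarith : 2 * (2 * β + β) + β ≤ δ)
    convert this using 1
    group
  have hζ' : ζ₁ = ζ₂ := inv_mul_eq_one.1 hζ
  obtain ⟨W, hW, hWc⟩ := c0
  have hk : k = g₁ * proj W := by rw [← hW, mul_inv_cancel_left]
  have hcomm : proj (W * diagMatrix T₂) = proj (diagMatrix T₁ * W) := by
    rw [map_mul, map_mul]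
    apply mul_left_cancel (a := g₁)
    rw [← mul_assoc, ← hk, e₂, ← mul_assoc, e₁, ← hζ', hk, mul_assoc]
  obtain ⟨hTT, z, rfl⟩ := eq_diagMatrix_of_commute hT₁ hWc (by linarith) hcomm
  refine ⟨hTT.symm, ?_⟩
  rw [hk, ← flow_pt, orbit_flow]

lemma expansive (hβ : 0 < β) (hβδ : 15 * β ≤ δ) (hδ : δ ≤ 1)
    (hinj : ∀ g : G, ∀ γ ∈ Γ, GClose δ (g⁻¹ * γ * g) → γ = 1) {x₁ x₂ : X Γ} {T₁ T₂ : ℝ}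
    (hT₁ : 0 < T₁) (hT₂ : 0 < T₂) (h₁ : flow Γ T₁ x₁ = x₁) (h₂ : flow Γ T₂ x₂ = x₂)
    (hT : |T₁ - T₂| ≤ β)
    (h : ∀ t ∈ Set.Icc 0 (min T₁ T₂), Near Γ β (flow Γ t x₁) (flow Γ t x₂)) :
    T₁ = T₂ ∧ orbit Γ x₁ = orbit Γ x₂ := by
  rcases le_total T₁ T₂ with hle | hle
  · rw [min_eq_left hle] at h
    exact expansive_of_le hβ hβδ hδ hinj hT₁ h₁ h₂ hT h
  · rw [min_eq_right hle] at h
    rw [abs_sub_comm] at hT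
    obtain ⟨h3, h4⟩ := expansive_of_le hβ hβδ hδ hinj hT₂ h₂ h₁ hT fun t ht => (h t ht).symm
    exact ⟨h3.symm, h4.symm⟩

end Expansivity

/-! ### Uniqueness of the partner orbit -/

lemma IsPeriodicOrbit.flow_eq {Γ : Subgroup G} {c : Set (X Γ)} {T : ℝ} (h : IsPeriodicOrbit Γ c T)
    {x : X Γ} (hx : x ∈ c) : flow Γ T x = x ∧ c = orbit Γ x := by
  obtain ⟨-, y, hy, rfl⟩ := h
  obtain ⟨s, rfl⟩ := hx
  exact ⟨by simp only; rw [← flow_add, add_comm, flow_add, hy], (orbit_flow Γ s y).symm⟩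

/-- Both orbits are near the reference point `y` at the times `u` and `v`. Moving to the common time
`r` costs `9 ε` each, and the triangle inequality gives `2 (2 · 9 + 6) + 9 = 57`. -/
lemma Near.of_shifts {Γ : Subgroup G} {ε u v r : ℝ} {x' x'' y : X Γ} (hε : ε ≤ 1 / 100)
    (h' : Near Γ (2 * ε) y (flow Γ u x')) (h'' : Near Γ (2 * ε) y (flow Γ v x''))
    (hu : |r - u| ≤ 9 * ε) (hv : |r - v| ≤ 9 * ε) :
    Near Γ (57 * ε) (flow Γ r x') (flow Γ r x'') := by
  have h1 := near_flow (Γ := Γ) hu (by linarith) x'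
  have h2 := near_flow (Γ := Γ) (by rwa [abs_sub_comm] at hv) (by linarith : 9 * ε ≤ 1) x''
  have h0 : 0 ≤ ε := by linarith [abs_nonneg (r - u)]
  refine ((h1.trans (h'.symm.trans h'' ?_) ?_).trans h2 ?_).mono ?_ <;> linarith

lemma Near.of_shifts_timeReversal {Γ : Subgroup G} {ε u v r : ℝ} {x' x'' y : X Γ}
    (hε : ε ≤ 1 / 100) (h' : Near Γ (2 * ε) y (HadamardGutzwiller.timeReversal Γ (flow Γ u x')))
    (h'' : Near Γ (2 * ε) y (HadamardGutzwiller.timeReversal Γ (flow Γ v x'')))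
    (hu : |r - u| ≤ 9 * ε) (hv : |r - v| ≤ 9 * ε) :
    Near Γ (57 * ε) (flow Γ r x') (flow Γ r x'') := by
  have h1 := h'.timeReversal
  have h2 := h''.timeReversal
  rw [timeReversal_timeReversal] at h1 h2
  exact Near.of_shifts hε h1 h2 hu hv

/-- Two orbits which differ in both encounters from the same orbit stay close to each other. -/
lemma DiffersInBothEncounters.near {Γ : Subgroup G} {ε T₁ T₂ T₃ T₄ T' T'' : ℝ} {x : X Γ}
    {c' c'' : Set (X Γ)} (hT₁ : 0 < T₁) (hT₂ : 0 < T₂) (hT₃ : 0 < T₃) (hT₄ : 0 < T₄)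
    (hε : ε ≤ 1 / 100)
    (h' : DiffersInBothEncounters Γ ε x T₁ T₂ T₃ T₄ c' T')
    (h'' : DiffersInBothEncounters Γ ε x T₁ T₂ T₃ T₄ c'' T'') :
    |T' - T''| ≤ 8 * ε ∧ ∃ x' ∈ c', ∃ x'' ∈ c'', ∀ r ∈ Set.Icc 0 (min T' T''),
      Near Γ (57 * ε) (flow Γ r x') (flow Γ r x'') := by
  obtain ⟨-, x', hx', t₁, t₂, t₃, p1, p2, p3, p4, a1, a2, a3, a4, s1, s2, s3, s4⟩ := h'
  obtain ⟨-, x'', hx'', v₁, v₂, v₃, q1, q2, q3, q4, b1, b2, b3, b4, w1, w2, w3, w4⟩ := h''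
  rw [abs_lt] at a1 a2 a3 a4 b1 b2 b3 b4
  obtain ⟨a1, a1'⟩ := a1
  obtain ⟨a2, a2'⟩ := a2
  obtain ⟨a3, a3'⟩ := a3
  obtain ⟨a4, a4'⟩ := a4
  obtain ⟨b1, b1'⟩ := b1
  obtain ⟨b2, b2'⟩ := b2
  obtain ⟨b3, b3'⟩ := b3
  obtain ⟨b4, b4'⟩ := b4
  have near : ∀ {ℓ s : ℝ} {y y' : X Γ}, StaysClose Γ ε ℓ y y' → 0 ≤ s → s ≤ ℓ →
      Near Γ (2 * ε) (flow Γ s y) (flow Γ s y') := fun h h0 h1 =>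
    near_of_distX_lt (by linarith) (h _ ⟨h0, h1⟩)
  have rev : ∀ (t s : ℝ) (y : X Γ), flow Γ s (flow Γ (-t) (timeReversal Γ y)) =
      timeReversal Γ (flow Γ (t - s) y) := fun t s y => by
    rw [← flow_add, flow_timeReversal]; congr 2; ring
  -- Each of the four durations differs by less than `ε` from `Tᵢ`, so two partners drift apart in
  -- time by at most `8 ε`. Another `ε` arises where `r` overshoots the piece of length `Tᵢ`; hence
  -- the truncations by `min` below.
  refine ⟨by rw [abs_le]; constructor <;> linarith, x', hx', x'', hx'', fun r hr => ?_⟩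
  have hr0 := hr.1
  have hrT : r ≤ T' := hr.2.trans (min_le_left _ _)
  rcases le_total r t₁ with hr1 | hr1
  · have hs := min_cases r T₁
    have n' := near s1 (le_min hr0 hT₁.le) (min_le_right r T₁)
    have n'' := near w1 (le_min hr0 hT₁.le) (min_le_right r T₁)
    refine Near.of_shifts hε n' n'' ?_ ?_ <;> rw [abs_le] <;> constructor <;>
      rcases hs with ⟨hs, hs'⟩ | ⟨hs, hs'⟩ <;> linarith
  rcases le_total r t₂ with hr2 | hr2
  · have hs := min_cases (t₂ - r) T₂
    have n' := near s2 (le_min (by linarith) hT₂.le) (min_le_right (t₂ - r) T₂)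
    have n'' := near w2 (le_min (by linarith) hT₂.le) (min_le_right (t₂ - r) T₂)
    rw [rev] at n' n''
    refine Near.of_shifts_timeReversal hε n' n'' ?_ ?_ <;> rw [abs_le] <;> constructor <;>
      rcases hs with ⟨hs, hs'⟩ | ⟨hs, hs'⟩ <;> linarith
  rcases le_total r t₃ with hr3 | hr3
  · have hs := min_cases (r - t₂) T₃
    have n' := near s3 (le_min (by linarith) hT₃.le) (min_le_right (r - t₂) T₃)
    have n'' := near w3 (le_min (by linarith) hT₃.le) (min_le_right (r - t₂) T₃)
    rw [← flow_add Γ t₂] at n'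
    rw [← flow_add Γ v₂] at n''
    refine Near.of_shifts hε n' n'' ?_ ?_ <;> rw [abs_le] <;> constructor <;>
      rcases hs with ⟨hs, hs'⟩ | ⟨hs, hs'⟩ <;> linarith
  · have hs := min_cases (T' - r) T₄
    have n' := near s4 (le_min (by linarith) hT₄.le) (min_le_right (T' - r) T₄)
    have n'' := near w4 (le_min (by linarith) hT₄.le) (min_le_right (T' - r) T₄)
    rw [rev] at n' n''
    refine Near.of_shifts_timeReversal hε n' n'' ?_ ?_ <;> rw [abs_le] <;> constructor <;>
      rcases hs with ⟨hs, hs'⟩ | ⟨hs, hs'⟩ <;> linarith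

/-- On a compact surface there is an expansivity constant below which orbits that differ in both
encounters from a given one are unique. -/
lemma exists_expansivityConstant (Γ : Subgroup G) [DiscreteTopology Γ] [CompactSpace (Surface Γ)] :
    ∃ ε₀ : ℝ, IsExpansivityConstant Γ ε₀ ∧
      ∀ (ε T₁ T₂ T₃ T₄ T' T'' : ℝ) (x : X Γ) (c' c'' : Set (X Γ)), ε ≤ ε₀ →
        0 < T₁ → 0 < T₂ → 0 < T₃ → 0 < T₄ →
        DiffersInBothEncounters Γ ε x T₁ T₂ T₃ T₄ c' T' →
        DiffersInBothEncounters Γ ε x T₁ T₂ T₃ T₄ c'' T'' → c' = c'' ∧ T' = T'' := by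
  obtain ⟨δ, hδ0, hδ1, hinj⟩ := exists_injectivity_radius Γ
  have hβ : 0 < δ / 15 := by positivity
  have hβδ : 15 * (δ / 15) ≤ δ := by linarith
  -- Small enough that `57 ε`, and also `2 ε` and the period differences, stay below `β = δ / 15`.
  refine ⟨δ / 1500, ⟨by positivity, ?_⟩, ?_⟩
  · intro ε hε hε0 x₁ x₂ T₁ T₂ hT₁ hT₂ h₁ h₂ hT h
    have hsqrt : Real.sqrt 2 ≤ 2 := by
      rw [Real.sqrt_le_left (by norm_num)]; norm_num
    refine expansive hβ hβδ hδ1 hinj hT₁ hT₂ h₁ h₂ (hT.trans (by nlinarith)) fun t ht => ?_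
    exact (near_of_distX_lt (by linarith) (h t ht)).mono (by linarith)
  · intro ε T₁ T₂ T₃ T₄ T' T'' x c' c'' hε hT₁ hT₂ hT₃ hT₄ h' h''
    obtain ⟨hT, x', hx', x'', hx'', hnear⟩ := h'.near hT₁ hT₂ hT₃ hT₄ (by linarith) h''
    obtain ⟨f', hc'⟩ := h'.1.flow_eq hx'
    obtain ⟨f'', hc''⟩ := h''.1.flow_eq hx''
    obtain ⟨h1, h2⟩ := expansive hβ hβδ hδ1 hinj h'.1.1 h''.1.1 f' f''
      (hT.trans (by linarith)) fun t ht => (hnear t ht).mono (by linarith)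
    exact ⟨by rw [hc', hc'', h2], h1⟩

end HadamardGutzwiller

end

theorem mainTheorem6 (Γ : Subgroup HadamardGutzwiller.G) [DiscreteTopology Γ]
    (hΓ : ∀ γ ∈ Γ, γ ≠ 1 → IsHyperbolic γ) :
    -- existence of the partner orbit, and the estimate for its period
    (∀ (p : ℝ → TX Γ) (T₁ T₂ T₃ T₄ θ₁ θ₂ T φ₁ φ₂ φ : ℝ) (x : X Γ),
      HasTwoSelfCrossings Γ p T₁ T₂ T₃ T₄ θ₁ θ₂ → toTX Γ x = p 0 →
      T = T₁ + T₂ + T₃ + T₄ → φ₁ = Real.pi - θ₁ → φ₂ = Real.pi - θ₂ → φ = max φ₁ φ₂ →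
      φ < 1 / 3 →
      ∃ (c' : Set (X Γ)) (T' : ℝ),
        IsPartner Γ (36 * |Real.sin (φ / 2)|) (orbit Γ x) T c' T' ∧
        DiffersInBothEncounters Γ (36 * |Real.sin (φ / 2)|) x T₁ T₂ T₃ T₄ c' T' ∧
        |(T' - T) / 2 -
            Real.log ((1 - Real.sin (φ₁ / 2) ^ 2) * (1 - Real.sin (φ₂ / 2) ^ 2))| <
          Real.sin (φ / 2) ^ 2 * (21 * Real.exp (-T₁) + 31 * Real.exp (-T₂) +
            13 * Real.exp (-T₃) + 19 * Real.exp (-T₄))) ∧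
    -- uniqueness of the partner orbit
    (CompactSpace (Surface Γ) →
      ∃ ε₀ : ℝ, IsExpansivityConstant Γ ε₀ ∧
        ∀ (p : ℝ → TX Γ) (T₁ T₂ T₃ T₄ θ₁ θ₂ T φ : ℝ) (x : X Γ),
          HasTwoSelfCrossings Γ p T₁ T₂ T₃ T₄ θ₁ θ₂ → toTX Γ x = p 0 →
          T = T₁ + T₂ + T₃ + T₄ → φ = max (Real.pi - θ₁) (Real.pi - θ₂) →
          φ < 1 / 3 → φ < ε₀ / 20 →
          ∀ (c' c'' : Set (X Γ)) (T' T'' : ℝ),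
            IsPartner Γ (36 * |Real.sin (φ / 2)|) (orbit Γ x) T c' T' →
            DiffersInBothEncounters Γ (36 * |Real.sin (φ / 2)|) x T₁ T₂ T₃ T₄ c' T' →
            IsPartner Γ (36 * |Real.sin (φ / 2)|) (orbit Γ x) T c'' T'' →
            DiffersInBothEncounters Γ (36 * |Real.sin (φ / 2)|) x T₁ T₂ T₃ T₄ c'' T'' →
            c' = c'' ∧ T' = T'') := by
  refine ⟨?_, fun hcomp => ?_⟩
  · intro p T₁ T₂ T₃ T₄ θ₁ θ₂ T φ₁ φ₂ φ x h hx hT hφ₁ hφ₂ hφ hφ3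
    subst hT hφ₁ hφ₂
    exact h.exists_partner hΓ hx hφ hφ3
  · obtain ⟨ε₀, hε₀, huniq⟩ := exists_expansivityConstant Γ
    refine ⟨ε₀, hε₀, ?_⟩
    intro p T₁ T₂ T₃ T₄ θ₁ θ₂ T φ x h _ _ hφ _ hφε c' c'' T' T'' _ hd' _ hd''
    have hφ0 : 0 < φ := by
      rw [hφ]
      exact lt_max_of_lt_left (sub_pos.2 h.crossing₁.2.2.1)
    have hsin : |Real.sin (φ / 2)| ≤ φ / 2 := by
      have := Real.abs_sin_le_abs (x := φ / 2)
      rwa [abs_of_pos (a := φ / 2) (by linarith)] at this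
    -- Here `36 |sin (φ/2)| ≤ 18 φ < (18/20) ε₀`.
    exact huniq _ T₁ T₂ T₃ T₄ T' T'' x c' c'' (by linarith [hε₀.1]) h.pos₁ h.crossing₁.1 h.pos₃
      h.crossing₂.1 hd' hd''
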